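/- **Setting.** There are $n$ users; user $u$ holds a private value $X_u\in[0,1]$. A subset $U^H$ of $n_H\ge 1$ users is honest, the others are malicious and collude; put $\rho=n_H/n$. On a graph $G=(U,E)$, GOPA with variances $\sigma_\eta^2,\sigma_\Delta^2$ works as follows: every edge $\{u,v\}\in E$ with $u<v$ draws $x\sim\mathcal N(0,\sigma_\Delta^2)$ and sets $\Delta_{u,v}=x$, $\Delta_{v,u}=-x$; every user $u$ draws $\eta_u\sim\mathcal N(0,\sigma_\eta^2)$ and publishes $\hat X_u=X_u+\sum_{v\in N(u)}\Delta_{u,v}+\eta_u$; all draws are independent. The draws in which malicious users take part (their $\eta_u$, and the $\Delta_{u,v}$ with $u$ or $v$ malicious) may even have an arbitrary joint law, possibly depending on the graph, as long as they are independent of the draws among honest users. The adversary sees $G$, all $\hat X_u$, the $X_u$ and $\eta_u$ of the malicious users, and all $\Delta_{u,v}$ with $u$ or $v$ malicious. GOPA is $(\varepsilon,\delta)$-DP if, for all inputs $X,X'\in[0,1]^n$ that differ only in the value of one honest user and every measurable set $\mathcal O$, the view $V(X)$ of the adversary satisfies $\Pr(V(X)\in\mathcal O)\le e^{\varepsilon}\Pr(V(X')\in\mathcal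 O)+\delta$. $G^H$ denotes the subgraph of $G$ induced by $U^H$. In a random $k$-out graph ($k<n$), every honest user selects $k$ other users uniformly at random and independently, the selections of malicious users are arbitrary (deterministic or random, independent of the honest ones, for instance also uniform), and $\{u,v\}\in E$ iff $u$ selected $v$ or $v$ selected $u$; the probabilities in the definition of DP are then also over the graph. **Statement.** Let $\varepsilon,\delta'\in(0,1)$, let $\sigma_\eta^2=\dfrac{c^2}{n_H\varepsilon^2}$ with $c^2>2\log(1.25/\delta')$, and let $\kappa>0$. 1. If $G^H$ is complete (in particular if $G$ is) and $\sigma_\Delta^2=\kappa\sigma_\eta^2$, then GOPA is $(\varepsilon,\delta)$-DP for every $\delta\ge 1.25\,(\delta'/1.25)^{\kappa/(\kappa+1)}$. 2. Let $G$ be a random $k$-out graph, $\sigma_\Delta^2=\kappa\sigma_\eta^2\, n_H\Big(\dfrac{1}{\lfloor (k-1)\rho/3\rfloor-1}+\dfrac{12+6\log n_H}{n_H}\Big)$ and $\delta\ge 3.75\,(\delta'/1.25)^{\kappa/(\kappa+1)}$. If $\rho n\ge 81$, $\rho k\ge 4\log(2\rho n/\delta)$, $\rho k\ge 6\log(\rho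 n/3)$ and $\rho k\ge\frac32+\frac94\log(6e/\delta)$, then the whole process (generation of $G$ followed by GOPA) is $(\varepsilon,\delta)$-DP. 3. If $G^H$ is connected and $\sigma_\Delta^2=\kappa\sigma_\eta^2\, n_H^2/3$, then GOPA is $(\varepsilon,\delta)$-DP for every $\delta\ge 1.25\,(\delta'/1.25)^{\kappa/(\kappa+1)}$. -/

import Mathlib

open MeasureTheory ProbabilityTheory
open scoped NNReal ENNReal

namespace Gopa

noncomputable section

/-! Users are the elements of `Fin n`; the set of honest users is a finset `H`. -/

/-- The random draws made in one run: `ω.1 u` is the independent noise `η_u` of user `u`, and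
`ω.2 s(u, v)` is the number `x` drawn jointly by `u` and `v` (draws that belong to no edge are
never used). -/
abbrev Noise (n : ℕ) : Type := (Fin n → ℝ) × (Sym2 (Fin n) → ℝ)

/-- The law prescribed by the protocol: all draws are independent, `η_u ∼ 𝒩(0, σ_η²)` and
`x ∼ 𝒩(0, σ_Δ²)`. -/
def protocolNoise (n : ℕ) (varEta varDelta : ℝ≥0) : Measure (Noise n) :=
  (Measure.pi fun _ : Fin n => gaussianReal 0 varEta).prod
    (Measure.pi fun _ : Sym2 (Fin n) => gaussianReal 0 varDelta)

open Classical in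
/-- The draws of a run in which honest users and pairs of honest users use the draws in `ω`, while
malicious users and pairs with at least one malicious member use the draws in `α`. -/
def merge {n : ℕ} (H : Finset (Fin n)) (ω α : Noise n) : Noise n :=
  (fun u => if u ∈ H then ω.1 u else α.1 u,
   fun e => if ∀ u ∈ e, u ∈ H then ω.2 e else α.2 e)

open Classical in
/-- `Δ_{u,v}`: for an edge `{u, v}` with `u < v`, `Δ_{u,v} = x` and `Δ_{v,u} = -x`; it is `0` when
`u` and `v` are not neighbors. -/
def pairNoise {n : ℕ} (G : SimpleGraph (Fin n)) (ω : Noise n) (u v : Fin n) : ℝ :=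
  if G.Adj u v then (if u < v then ω.2 s(u, v) else - ω.2 s(u, v)) else 0

open Classical in
/-- The published value `X_u + ∑_{v ∈ N(u)} Δ_{u,v} + η_u` of user `u`. -/
def noisyValue {n : ℕ} (G : SimpleGraph (Fin n)) (X : Fin n → ℝ) (ω : Noise n) (u : Fin n) : ℝ :=
  X u + ∑ v ∈ G.neighborFinset u, pairNoise G ω u v + ω.1 u

/-- What the adversary sees: the network graph, the published values of all users, the private
values and the independent noise of the malicious users, and all `Δ_{u,v}` for which `u` or `v` is
malicious. -/
abbrev View (n : ℕ) (H : Finset (Fin n)) : Type :=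
  SimpleGraph (Fin n) × (Fin n → ℝ) × ({u : Fin n // u ∉ H} → ℝ) × ({u : Fin n // u ∉ H} → ℝ) ×
    ({p : Fin n × Fin n // p.1 ∉ H ∨ p.2 ∉ H} → ℝ)

/-- The adversary's view of a run on the graph `G` with private values `X` and draws `ω`. -/
def view {n : ℕ} (G : SimpleGraph (Fin n)) (H : Finset (Fin n)) (X : Fin n → ℝ) (ω : Noise n) :
    View n H :=
  (G, fun u => noisyValue G X ω u, fun u => X u, fun u => ω.1 u,
    fun p => pairNoise G ω p.1.1 p.1.2)

/-- The view is a measurable function of the draws, so the image measure below is not a junk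
value. -/
theorem measurable_view {n : ℕ} (G : SimpleGraph (Fin n)) (H : Finset (Fin n)) (X : Fin n → ℝ) :
    Measurable fun p : Noise n × Noise n => view G H X (merge H p.1 p.2) := by
  have h1 : ∀ u, Measurable fun p : Noise n × Noise n => (merge H p.1 p.2).1 u := by
    intro u
    by_cases h : u ∈ H <;> simp only [merge, h, if_true, if_false] <;> fun_prop
  have h2 : ∀ e, Measurable fun p : Noise n × Noise n => (merge H p.1 p.2).2 e := by
    intro e
    by_cases h : ∀ u ∈ e, u ∈ H
    · simp only [merge, if_pos h]; fun_prop
    · simp only [merge, if_neg h]; fun_prop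
  have h3 : ∀ u v, Measurable fun p : Noise n × Noise n => pairNoise G (merge H p.1 p.2) u v := by
    intro u v
    have := h2 s(u, v)
    by_cases h : G.Adj u v <;> by_cases h' : u < v <;>
      simp only [pairNoise, h, h', if_true, if_false] <;> fun_prop
  unfold view noisyValue
  fun_prop

/-- The law of the adversary's view when GOPA is run on the graph `G` with private values `X`. The
draws among honest users follow the protocol; those in which malicious users take part have the
joint law `ν`, independently. The case where malicious users also follow the protocol is
`ν = protocolNoise n varEta varDelta`. -/
def gopa {n : ℕ} (G : SimpleGraph (Fin n)) (H : Finset (Fin n)) (varEta varDelta : ℝ≥0)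
    (ν : Measure (Noise n)) (X : Fin n → ℝ) : Measure (View n H) :=
  ((protocolNoise n varEta varDelta).prod ν).map fun p => view G H X (merge H p.1 p.2)

/-- All ways in which every user can select `k` other users. -/
def selections (n k : ℕ) : Finset (Fin n → Finset (Fin n)) :=
  Fintype.piFinset fun u => (Finset.univ.erase u).powersetCard k

theorem selections_nonempty {n k : ℕ} (hk : k < n) : (selections n k).Nonempty := by
  refine Fintype.piFinset_nonempty.2 fun u => Finset.powersetCard_nonempty.2 ?_
  rw [Finset.card_erase_of_mem (Finset.mem_univ u), Finset.card_univ, Fintype.card_fin]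
  omega

/-- The graph in which `{u, v}` is an edge iff `u` selected `v` or `v` selected `u`. -/
def selectionGraph {n : ℕ} (S : Fin n → Finset (Fin n)) : SimpleGraph (Fin n) :=
  SimpleGraph.fromRel fun u v => v ∈ S u

open Classical in
/-- The random `k`-out graph: honest users select `k` other users uniformly at random and
independently; the selections of the malicious users have the joint law `Q`, independently of the
honest ones. The case where malicious users also follow the protocol is
`Q = PMF.uniformOfFinset (selections n k) _`. -/
def kOutGraph {n : ℕ} (H : Finset (Fin n)) (k : ℕ) (hk : k < n)
    (Q : PMF (Fin n → Finset (Fin n))) : PMF (SimpleGraph (Fin n)) :=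
  (PMF.uniformOfFinset (selections n k) (selections_nonempty hk)).bind fun S =>
    Q.map fun M => selectionGraph fun u => if u ∈ H then S u else M u

/-- The law of the adversary's view of the whole process: the graph is drawn from `P`, and then GOPA
is run on it. The draws of the malicious users may depend on the graph. -/
def gopaOnRandomGraph {n : ℕ} (P : PMF (SimpleGraph (Fin n))) (H : Finset (Fin n))
    (varEta varDelta : ℝ≥0) (ν : SimpleGraph (Fin n) → ProbabilityMeasure (Noise n))
    (X : Fin n → ℝ) : Measure (View n H) :=
  Measure.sum fun G => P G • gopa G H varEta varDelta (ν G : Measure (Noise n)) X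

/-- `(ε, δ)`-differential privacy of a mechanism `A` that maps the private values, which lie in
`[0, 1]`, to the law of its output; neighboring inputs differ only in the value of one honest
user. -/
def IsDP {n : ℕ} {Ω : Type*} [MeasurableSpace Ω] (H : Finset (Fin n)) (ε δ : ℝ)
    (A : (Fin n → ℝ) → Measure Ω) : Prop :=
  ∀ v ∈ H, ∀ X X' : Fin n → ℝ,
    (∀ u, X u ∈ Set.Icc (0 : ℝ) 1) → (∀ u, X' u ∈ Set.Icc (0 : ℝ) 1) →
    (∀ u, u ≠ v → X u = X' u) →
    ∀ O : Set Ω, MeasurableSet O →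
      A X O ≤ ENNReal.ofReal (Real.exp ε) * A X' O + ENNReal.ofReal δ

end

end Gopa

/-!
If the inputs differ by `a` at the honest user `v`, let `g` be a flow on the honest subgraph that
spreads one unit of mass at `v` evenly over the `n_H` honest users. Shifting each `Δ_{u,w}` by
`a * g u w` and each honest `η_u` by `a / n_H` turns one run into another with the same view. The
privacy loss of this Gaussian shift is governed by its squared length
`a² (1 / (n_H σ_η²) + energy(g) / σ_Δ²)`, and for `σ_Δ² = κ σ_η² n_H B` with `energy(g) ≤ B` this is
at most `(κ + 1) / κ` times the contribution of the independent noise alone, whence the exponent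
`κ / (κ + 1)`.

It remains to find flows of small energy. On a complete graph send `1 / n_H` along each edge at `v`,
on a connected graph take the electrical flow and bound its potential drops cut by cut. On a graph
with expansion `τ`, the potential of the electrical flow drops by at most
`(1 / 2 ^ j + 4 / n_H) / τ` between the upper level sets of sizes `2 ^ j` and `2 ^ (j + 1)`, and by
at most `2 / (τ n_H)` between the corresponding lower ones; these drops add up to an energy bound.
A random `k`-out graph fails to expand with small probability, by a Chernoff bound for negatively
correlated selections and a union bound over pairs of disjoint sets of honest users.
-/

namespace Gopa

section Gaussian

theorem gaussianReal_eq_withDensity (h : ℝ) {v : ℝ≥0} (hv : v ≠ 0) :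
    gaussianReal h v = (gaussianReal 0 v).withDensity
      fun x => ENNReal.ofReal (Real.exp (h * x / v - h ^ 2 / (2 * v))) := by
  have hv' : (v : ℝ) ≠ 0 := NNReal.coe_ne_zero.2 hv
  rw [gaussianReal_of_var_ne_zero _ hv, gaussianReal_of_var_ne_zero _ hv,
    ← withDensity_mul _ (measurable_gaussianPDF _ _) (by fun_prop)]
  congr 1
  ext x
  simp only [Pi.mul_apply, gaussianPDF, gaussianPDFReal]
  rw [← ENNReal.ofReal_mul (by positivity), mul_assoc (√(2 * Real.pi * v))⁻¹, ← Real.exp_add]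
  congr 3
  field_simp
  ring

theorem gaussianReal_Ioi_zero_le (v : ℝ≥0) :
    gaussianReal 0 v (Set.Ioi 0) ≤ ENNReal.ofReal (1 / 2) := by
  have symm : gaussianReal 0 v (Set.Iio 0) = gaussianReal 0 v (Set.Ioi 0) := by
    have neg := gaussianReal_map_neg (μ := 0) (v := v)
    rw [neg_zero] at neg
    conv_lhs => rw [← neg, Measure.map_apply measurable_neg measurableSet_Iio]
    congr 1
    ext x
    simp
  have total : gaussianReal 0 v (Set.Iio 0) + gaussianReal 0 v (Set.Ioi 0) ≤ 1 := by
    rw [← measure_union Set.Ioi_disjoint_Iio_same.symm measurableSet_Ioi]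
    exact prob_le_one
  rw [symm, ← two_mul] at total
  rw [ENNReal.ofReal_div_of_pos two_pos, ENNReal.ofReal_one,
    ENNReal.le_div_iff_mul_le (by simp) (by simp), mul_comm]
  simpa using total

theorem gaussianReal_Ioi_le_exp {v : ℝ≥0} (hv : v ≠ 0) {s : ℝ} (hs : 0 ≤ s) :
    gaussianReal 0 v (Set.Ioi s) ≤ ENNReal.ofReal (1 / 2 * Real.exp (-(s ^ 2 / (2 * v)))) := by
  have translate : gaussianReal 0 v (Set.Ioi s) = gaussianReal (-s) v (Set.Ioi 0) := by
    rw [← zero_add (-s), ← gaussianReal_map_add_const,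
      Measure.map_apply (by fun_prop) measurableSet_Ioi]
    simp
  rw [translate, gaussianReal_eq_withDensity _ hv, withDensity_apply _ measurableSet_Ioi]
  calc ∫⁻ x in Set.Ioi 0, ENNReal.ofReal (Real.exp (-s * x / v - (-s) ^ 2 / (2 * v)))
        ∂gaussianReal 0 v
      ≤ ∫⁻ _ in Set.Ioi 0, ENNReal.ofReal (Real.exp (-(s ^ 2 / (2 * v)))) ∂gaussianReal 0 v := by
        refine setLIntegral_mono measurable_const fun x hx => ?_
        gcongr
        have : 0 ≤ s * x / v := div_nonneg (mul_nonneg hs (le_of_lt hx)) v.2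
        rw [neg_mul, neg_div, neg_sq]
        linarith
    _ ≤ ENNReal.ofReal (1 / 2 * Real.exp (-(s ^ 2 / (2 * v)))) := by
        rw [setLIntegral_const, mul_comm, ENNReal.ofReal_mul (by norm_num)]
        gcongr
        exact gaussianReal_Ioi_zero_le v

theorem gaussianPDFReal_le {v : ℝ≥0} (hv : v ≠ 0) (m x : ℝ) :
    gaussianPDFReal m v x ≤ 1 / (2 * √v) := by
  have hv' : (0 : ℝ) < v := by positivity
  have hexp : Real.exp (-(x - m) ^ 2 / (2 * v)) ≤ 1 := by
    rw [Real.exp_le_one_iff, neg_div, neg_nonpos]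
    positivity
  calc gaussianPDFReal m v x
      ≤ (√(2 * Real.pi * v))⁻¹ * 1 := mul_le_mul_of_nonneg_left hexp (by positivity)
    _ ≤ 1 / (2 * √v) := by
        rw [mul_one, ← one_div]
        refine one_div_le_one_div_of_le (by positivity) (Real.le_sqrt_of_sq_le ?_)
        rw [mul_pow, Real.sq_sqrt hv'.le]
        nlinarith [Real.pi_gt_three]

theorem gaussianReal_Ioi_le_of_nonpos {v : ℝ≥0} (hv : v ≠ 0) {s : ℝ} (hs : s ≤ 0) :
    gaussianReal 0 v (Set.Ioi s) ≤ ENNReal.ofReal (1 / 2 + -s / (2 * √v)) := by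
  have hIoc : gaussianReal 0 v (Set.Ioc s 0) ≤ ENNReal.ofReal (-s / (2 * √v)) :=
    calc gaussianReal 0 v (Set.Ioc s 0)
        = ∫⁻ x in Set.Ioc s 0, gaussianPDF 0 v x := gaussianReal_apply _ hv _
      _ ≤ ∫⁻ _ in Set.Ioc s 0, ENNReal.ofReal (1 / (2 * √v)) :=
          setLIntegral_mono measurable_const fun x _ =>
            ENNReal.ofReal_le_ofReal (gaussianPDFReal_le hv 0 x)
      _ = ENNReal.ofReal (-s / (2 * √v)) := by
          rw [setLIntegral_const, Real.volume_Ioc, ← ENNReal.ofReal_mul (by positivity)]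
          ring_nf
  rw [← Set.Ioc_union_Ioi_eq_Ioi hs, add_comm, ENNReal.ofReal_add
    (div_nonneg (neg_nonneg.2 hs) (by positivity)) (by norm_num)]
  exact (measure_union_le _ _).trans (add_le_add hIoc (gaussianReal_Ioi_zero_le v))

theorem gaussianReal_Ioi_sub_half_le_of_nonneg {ε C : ℝ} (hε1 : ε ≤ 1) {q : ℝ≥0} (hq0 : q ≠ 0)
    (hq : q * C ≤ ε ^ 2) (hs : 0 ≤ ε - q / 2) :
    gaussianReal 0 q (Set.Ioi (ε - q / 2)) ≤ ENNReal.ofReal (1.25 * Real.exp (-(C / 2))) := by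
  have : (0 : ℝ) < q := by positivity
  have hexponent : C / 2 - 1 / 2 ≤ (ε - q / 2) ^ 2 / (2 * q) := by
    rw [le_div_iff₀ (by positivity)]
    nlinarith [sq_nonneg (q : ℝ)]
  have hexp_half : Real.exp (1 / 2) ≤ 2.5 := by
    have hsq : Real.exp (1 / 2) ^ 2 = Real.exp 1 := by rw [← Real.exp_nat_mul]; norm_num
    nlinarith [Real.exp_one_lt_d9]
  refine (gaussianReal_Ioi_le_exp hq0 hs).trans (ENNReal.ofReal_le_ofReal ?_)
  calc 1 / 2 * Real.exp (-((ε - q / 2) ^ 2 / (2 * q)))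
      ≤ 1 / 2 * Real.exp (1 / 2 + -(C / 2)) := by gcongr; linarith
    _ = 1 / 2 * (Real.exp (1 / 2) * Real.exp (-(C / 2))) := by rw [Real.exp_add]
    _ ≤ 1 / 2 * (2.5 * Real.exp (-(C / 2))) := by gcongr
    _ = 1.25 * Real.exp (-(C / 2)) := by ring

-- In this regime `C ≤ 1/2`, so the target `1.25 * exp (-C/2)` is at least `0.93`.
theorem gaussianReal_Ioi_sub_half_le_of_nonpos {ε C : ℝ} (hε0 : 0 < ε) (hε1 : ε ≤ 1)
    (hC : 0.4 ≤ C) {q : ℝ≥0} (hq : q * C ≤ ε ^ 2) (hs : ε - q / 2 ≤ 0) :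
    gaussianReal 0 q (Set.Ioi (ε - q / 2)) ≤ ENNReal.ofReal (1.25 * Real.exp (-(C / 2))) := by
  have hqpos : (0 : ℝ) < q := by linarith
  have hroot : 0 < √(q : ℝ) := Real.sqrt_pos.2 hqpos
  have hroot_sq : √(q : ℝ) ^ 2 = q := Real.sq_sqrt hqpos.le
  have hC_le : C ≤ 1 / 2 := by
    by_contra! h
    nlinarith
  have hroot_le : √(q : ℝ) * 0.63 ≤ ε := by nlinarith
  have hshift : -(ε - q / 2) / (2 * √q) ≤ 0.25 := by
    rw [div_le_iff₀ (by positivity)]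
    nlinarith
  refine (gaussianReal_Ioi_le_of_nonpos (NNReal.coe_pos.1 hqpos).ne' hs).trans
    (ENNReal.ofReal_le_ofReal ?_)
  calc 1 / 2 + -(ε - q / 2) / (2 * √q)
      ≤ 0.75 := by norm_num at hshift ⊢; linarith
    _ ≤ 1.25 * (-(C / 2) + 1) := by norm_num; linarith
    _ ≤ 1.25 * Real.exp (-(C / 2)) := by gcongr; exact Real.add_one_le_exp _

theorem gaussianReal_Ioi_sub_half_le {ε δ C : ℝ} (hε0 : 0 < ε) (hε1 : ε ≤ 1) (hδ0 : 0 < δ)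
    (hδ1 : δ ≤ 1) (hC : 2 * Real.log (1.25 / δ) < C) (q : ℝ≥0) (hq : q * C ≤ ε ^ 2) :
    gaussianReal 0 q (Set.Ioi (ε - q / 2)) ≤ ENNReal.ofReal δ := by
  have hC_ge : 0.4 ≤ C := by
    have hlog : Real.log 1.25 ≤ Real.log (1.25 / δ) :=
      Real.log_le_log (by norm_num) (le_div_self (by norm_num) hδ0 hδ1)
    have h125 : 1 - 1.25⁻¹ ≤ Real.log 1.25 := Real.one_sub_inv_le_log_of_pos (by norm_num)
    norm_num at h125 hlog hC ⊢
    linarith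
  have hδ_ge : 1.25 * Real.exp (-(C / 2)) ≤ δ := by
    have hexp : 1.25 / δ ≤ Real.exp (C / 2) := by
      rw [← Real.log_le_iff_le_exp (by positivity)]
      linarith
    rw [Real.exp_neg, ← div_eq_mul_inv]
    exact (div_le_comm₀ hδ0 (Real.exp_pos _)).1 hexp
  refine le_trans ?_ (ENNReal.ofReal_le_ofReal hδ_ge)
  rcases le_total (ε - q / 2) 0 with hs | hs
  · exact gaussianReal_Ioi_sub_half_le_of_nonpos hε0 hε1 hC_ge hq hs
  · rcases eq_or_ne q 0 with rfl | hq0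
    · simp [gaussianReal_zero_var, hε0.le]
    · exact gaussianReal_Ioi_sub_half_le_of_nonneg hε1 hq0 hq hs

variable {ι : Type*} [Fintype ι]

theorem pi_withDensity {Ω : ι → Type*} [∀ i, MeasurableSpace (Ω i)] (μ : ∀ i, Measure (Ω i))
    [∀ i, IsProbabilityMeasure (μ i)] {f : ∀ i, Ω i → ℝ≥0∞} (hf : ∀ i, Measurable (f i))
    [∀ i, SigmaFinite ((μ i).withDensity (f i))] :
    Measure.pi (fun i => (μ i).withDensity (f i)) =
      (Measure.pi μ).withDensity fun x => ∏ i, f i (x i) := by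
  refine Measure.pi_eq fun s hs => ?_
  have hm : ∀ i, Measurable ((s i).indicator (f i)) := fun i => (hf i).indicator (hs i)
  have hind : (Set.univ.pi s).indicator (fun x : ∀ i, Ω i => ∏ i, f i (x i)) =
      fun x => ∏ i, (s i).indicator (f i) (x i) := by
    ext x
    by_cases hx : x ∈ Set.univ.pi s
    · rw [Set.indicator_of_mem hx]
      exact Finset.prod_congr rfl fun i _ => (Set.indicator_of_mem (hx i trivial) _).symm
    · obtain ⟨i, hi⟩ : ∃ i, x i ∉ s i := by simpa [Set.mem_univ_pi] using hx
      rw [Set.indicator_of_notMem hx]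
      exact (Finset.prod_eq_zero (Finset.mem_univ i) (Set.indicator_of_notMem hi _)).symm
  rw [withDensity_apply _ (MeasurableSet.univ_pi hs),
    ← lintegral_indicator (MeasurableSet.univ_pi hs), hind,
    lintegral_prod_eq_prod_lintegral_of_indepFun Finset.univ
      (fun i (x : ∀ i, Ω i) => (s i).indicator (f i) (x i))
      (iIndepFun_pi fun i => (hm i).aemeasurable) fun i => (hm i).comp (measurable_pi_apply i)]
  refine Finset.prod_congr rfl fun i _ => ?_
  rw [withDensity_apply _ (hs i), ← lintegral_indicator (hs i)]
  exact (measurePreserving_eval μ i).lintegral_comp (hm i)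

/-- The law of a family of independent centred Gaussian variables with variances `v`. -/
noncomputable abbrev gaussianPi (v : ι → ℝ≥0) : Measure (ι → ℝ) :=
  Measure.pi fun i => gaussianReal 0 (v i)

variable {v : ι → ℝ≥0}

theorem gaussianPi_map_add_const (v : ι → ℝ≥0) (h : ι → ℝ) :
    (gaussianPi v).map (· + h) = Measure.pi fun i => gaussianReal (h i) (v i) := by
  have hpi := Measure.pi_map_pi (μ := fun i => gaussianReal 0 (v i)) (f := fun i x => x + h i)
    fun i => by fun_prop
  simp only [gaussianReal_map_add_const, zero_add] at hpi
  exact hpi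

theorem gaussianPi_map_add_const_eq_withDensity (hv : ∀ i, v i ≠ 0) (h : ι → ℝ) :
    (gaussianPi v).map (· + h) = (gaussianPi v).withDensity fun x =>
      ENNReal.ofReal (Real.exp (∑ i, (h i * x i / v i - h i ^ 2 / (2 * v i)))) := by
  have hdensity : ∀ i, gaussianReal (h i) (v i) = (gaussianReal 0 (v i)).withDensity
      fun x => ENNReal.ofReal (Real.exp (h i * x / v i - h i ^ 2 / (2 * v i))) :=
    fun i => gaussianReal_eq_withDensity (h i) (hv i)
  have : ∀ i, SigmaFinite ((gaussianReal 0 (v i)).withDensity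
      fun x => ENNReal.ofReal (Real.exp (h i * x / v i - h i ^ 2 / (2 * v i)))) := fun i => by
    rw [← hdensity i]; infer_instance
  simp only [gaussianPi_map_add_const, hdensity]
  rw [pi_withDensity _ fun i => by fun_prop]
  congr 1
  ext x
  rw [Real.exp_sum, ENNReal.ofReal_prod_of_nonneg fun i _ => (Real.exp_pos _).le]

theorem gaussianPi_map_sum_mul (v : ι → ℝ≥0) (b : ι → ℝ) :
    (gaussianPi v).map (fun x => ∑ i, b i * x i) =
      gaussianReal 0 (∑ i, b i ^ 2 * v i).toNNReal := by
  have hindep : iIndepFun (fun i (x : ι → ℝ) => b i * x i) (gaussianPi v) :=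
    iIndepFun_pi (X := fun i y => b i * y) fun i => by fun_prop
  have hgauss : ∀ i, HasGaussianLaw (fun x : ι → ℝ => b i * x i) (gaussianPi v) := fun i =>
    ⟨by
      have hlaw : (gaussianPi v).map (fun x : ι → ℝ => b i * x i) =
          (gaussianReal 0 (v i)).map (b i * ·) := by
        rw [← (measurePreserving_eval (fun i => gaussianReal 0 (v i)) i).map_eq,
          Measure.map_map (by fun_prop) (by fun_prop)]
        rfl
      rw [hlaw, gaussianReal_map_const_mul]
      infer_instance⟩
  have hmean : ∫ x, ∑ i, b i * x i ∂gaussianPi v = 0 := by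
    rw [integral_finsetSum _ fun i _ => (hgauss i).integrable]
    refine Finset.sum_eq_zero fun i _ => ?_
    rw [integral_const_mul, integral_comp_eval (μ := fun i => gaussianReal 0 (v i)) (i := i)
      (f := fun y : ℝ => y) (by fun_prop), integral_id_gaussianReal, mul_zero]
  have hvar : Var[fun x => ∑ i, b i * x i; gaussianPi v] = ∑ i, b i ^ 2 * v i := by
    have hsum := variance_sum_pi (μ := fun i => gaussianReal 0 (v i)) (X := fun i y => b i * y)
      fun i => (memLp_id_gaussianReal 2).const_mul _
    have hterm : ∀ i, Var[fun y => b i * y; gaussianReal 0 (v i)] = b i ^ 2 * v i := fun i => by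
      rw [variance_const_mul, variance_fun_id_gaussianReal]
    rw [← Finset.sum_congr rfl fun i _ => hterm i, ← hsum]
    congr 1
    ext x
    simp
  rw [(hindep.hasGaussianLaw_fun_sum hgauss).map_eq_gaussianReal, hmean, hvar]

theorem gaussianPi_map_add_const_apply_le (hv : ∀ i, v i ≠ 0) (h : ι → ℝ) (ε : ℝ)
    {S : Set (ι → ℝ)} (hS : MeasurableSet S) :
    (gaussianPi v).map (· + h) S ≤ ENNReal.ofReal (Real.exp ε) * gaussianPi v S +
      gaussianReal 0 (∑ i, h i ^ 2 / v i).toNNReal (Set.Ioi (ε - (∑ i, h i ^ 2 / v i) / 2)) := by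
  set loss : (ι → ℝ) → ℝ := fun x => ∑ i, (h i * x i / v i - h i ^ 2 / (2 * v i)) with hloss
  set q := ∑ i, h i ^ 2 / (v i : ℝ) with hq
  have hv' : ∀ i, (v i : ℝ) ≠ 0 := fun i => NNReal.coe_ne_zero.2 (hv i)
  have hT : MeasurableSet {x | loss x ≤ ε} := measurableSet_le (by fun_prop) measurable_const
  have hsmall : (gaussianPi v).map (· + h) (S ∩ {x | loss x ≤ ε}) ≤
      ENNReal.ofReal (Real.exp ε) * gaussianPi v S := by
    rw [gaussianPi_map_add_const_eq_withDensity hv h, withDensity_apply _ (hS.inter hT)]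
    calc ∫⁻ x in S ∩ {x | loss x ≤ ε}, ENNReal.ofReal (Real.exp (loss x)) ∂gaussianPi v
        ≤ ∫⁻ _ in S ∩ {x | loss x ≤ ε}, ENNReal.ofReal (Real.exp ε) ∂gaussianPi v :=
          setLIntegral_mono measurable_const fun x hx =>
            ENNReal.ofReal_le_ofReal (Real.exp_le_exp.2 hx.2)
      _ ≤ ENNReal.ofReal (Real.exp ε) * gaussianPi v S := by
          rw [setLIntegral_const]
          gcongr
          exact Set.inter_subset_left
  have hlarge : (gaussianPi v).map (· + h) {x | loss x ≤ ε}ᶜ =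
      gaussianReal 0 q.toNNReal (Set.Ioi (ε - q / 2)) := by
    have hvar : q = ∑ i, (h i / v i) ^ 2 * v i :=
      Finset.sum_congr rfl fun i _ => by have := hv' i; field_simp
    have hshift : ∀ x, loss (x + h) = ∑ i, h i / v i * x i + q / 2 := fun x => by
      rw [hloss, hq, Finset.sum_div, ← Finset.sum_add_distrib]
      refine Finset.sum_congr rfl fun i _ => ?_
      have := hv' i
      simp only [Pi.add_apply]
      field_simp
      ring
    rw [hvar, ← gaussianPi_map_sum_mul v (fun i => h i / v i), ← hvar,
      Measure.map_apply (by fun_prop) hT.compl, Measure.map_apply (by fun_prop) measurableSet_Ioi]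
    congr 1
    ext x
    simp [hshift, sub_lt_iff_lt_add]
  calc (gaussianPi v).map (· + h) S
      ≤ (gaussianPi v).map (· + h) (S ∩ {x | loss x ≤ ε} ∪ {x | loss x ≤ ε}ᶜ) :=
        measure_mono fun x hx => (em (loss x ≤ ε)).imp (⟨hx, ·⟩) id
    _ ≤ _ := (measure_union_le _ _).trans (add_le_add hsmall hlarge.le)

theorem gaussianPi_map_add_const_apply_le_of_sum_le (hv : ∀ i, v i ≠ 0) (h : ι → ℝ) {ε δ C : ℝ}
    (hε0 : 0 < ε) (hε1 : ε ≤ 1) (hδ0 : 0 < δ) (hC : 2 * Real.log (1.25 / δ) < C)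
    (hq : (∑ i, h i ^ 2 / v i) * C ≤ ε ^ 2) {S : Set (ι → ℝ)} (hS : MeasurableSet S) :
    (gaussianPi v).map (· + h) S ≤
      ENNReal.ofReal (Real.exp ε) * gaussianPi v S + ENNReal.ofReal δ := by
  rcases le_total δ 1 with hδ1 | hδ1
  · have hq0 : 0 ≤ ∑ i, h i ^ 2 / (v i : ℝ) := Finset.sum_nonneg fun i _ => by positivity
    have htail := gaussianReal_Ioi_sub_half_le hε0 hε1 hδ0 hδ1 hC (∑ i, h i ^ 2 / v i).toNNReal
      (by rwa [Real.coe_toNNReal _ hq0])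
    rw [Real.coe_toNNReal _ hq0] at htail
    exact (gaussianPi_map_add_const_apply_le hv h ε hS).trans (by gcongr)
  · have : IsProbabilityMeasure ((gaussianPi v).map (· + h)) :=
      Measure.isProbabilityMeasure_map (by fun_prop)
    exact prob_le_one.trans ((ENNReal.one_le_ofReal.2 hδ1).trans le_add_self)

theorem protocolNoise_map_add_const_apply_le {n : ℕ} {varEta varDelta : ℝ≥0} (hE : varEta ≠ 0)
    (hD : varDelta ≠ 0) (h : Noise n) {ε δ C : ℝ} (hε0 : 0 < ε) (hε1 : ε ≤ 1) (hδ0 : 0 < δ)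
    (hC : 2 * Real.log (1.25 / δ) < C)
    (hq : ((∑ u, h.1 u ^ 2) / varEta + (∑ e, h.2 e ^ 2) / varDelta) * C ≤ ε ^ 2)
    {S : Set (Noise n)} (hS : MeasurableSet S) :
    (protocolNoise n varEta varDelta).map (· + h) S ≤
      ENNReal.ofReal (Real.exp ε) * protocolNoise n varEta varDelta S + ENNReal.ofReal δ := by
  set v : Fin n ⊕ Sym2 (Fin n) → ℝ≥0 := Sum.elim (fun _ => varEta) (fun _ => varDelta) with hv
  have hmp := measurePreserving_sumPiEquivProdPi fun i => gaussianReal 0 (v i)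
  have hlaw : protocolNoise n varEta varDelta =
      (gaussianPi v).map (MeasurableEquiv.sumPiEquivProdPi fun _ => ℝ) := hmp.map_eq.symm
  have hm := hmp.measurable
  have hpi := gaussianPi_map_add_const_apply_le_of_sum_le (v := v)
    (by rintro (i | i) <;> simpa [hv]) (Sum.elim h.1 h.2) hε0 hε1 hδ0 hC
    (by simpa [Fintype.sum_sum_type, hv, Finset.sum_div] using hq) (hm hS)
  rw [Measure.map_apply (by fun_prop) (hm hS)] at hpi
  rw [hlaw, Measure.map_map (by fun_prop) hm, Measure.map_apply hm hS,
    Measure.map_apply ((by fun_prop : Measurable fun x : Noise n => x + h).comp hm) hS]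
  exact hpi

end Gaussian

section Flow

variable {V : Type*}

/-- A flow on `G` that spreads one unit of mass at `v` evenly over all vertices. Its values are the
shifts of the pairwise noise terms by which a change of the private value of `v` is hidden. -/
structure IsSpreadingFlow [Fintype V] [DecidableEq V] (G : SimpleGraph V) (v : V)
    (g : V → V → ℝ) : Prop where
  antisymm : ∀ u w, g w u = -g u w
  eq_zero_of_not_adj : ∀ u w, ¬G.Adj u w → g u w = 0
  sum_eq : ∀ u, ∑ w, g u w = (if u = v then 1 else 0) - 1 / (Fintype.card V : ℝ)

/-- The energy of a flow. The sum counts every edge in both directions, hence the factor `1 / 2`. -/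
noncomputable def flowEnergy [Fintype V] (g : V → V → ℝ) : ℝ :=
  (∑ u, ∑ w, g u w ^ 2) / 2

open Classical in
/-- The electrical flow on `G`, with unit resistances, driven by the potential `f`. -/
noncomputable def edgeFlow (G : SimpleGraph V) (f : V → ℝ) (u w : V) : ℝ :=
  if G.Adj u w then f u - f w else 0

open Classical in
/-- The number of edges between `A` and `C`. This is the cardinality of `SimpleGraph.interedges`
with a classical decidability instance, and counts ordered pairs. -/
noncomputable def edgeCount (G : SimpleGraph V) (A C : Finset V) : ℕ :=
  (G.interedges A C).card

theorem sum_sum_eq_zero_of_antisymm {g : V → V → ℝ} (hg : ∀ u w, g w u = -g u w) (A : Finset V) :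
    ∑ u ∈ A, ∑ w ∈ A, g u w = 0 := by
  have hneg : ∑ u ∈ A, ∑ w ∈ A, g u w = -∑ u ∈ A, ∑ w ∈ A, g u w := by
    conv_lhs => rw [Finset.sum_comm]
    simp only [← Finset.sum_neg_distrib, ← hg]
  linarith

theorem IsSpreadingFlow.sum_sum_eq [Fintype V] [DecidableEq V] {G : SimpleGraph V} {v : V}
    {g : V → V → ℝ} (hg : IsSpreadingFlow G v g) (A : Finset V) :
    ∑ u ∈ A, ∑ w, g u w = (if v ∈ A then 1 else 0) - (A.card : ℝ) / Fintype.card V := by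
  simp only [hg.sum_eq, Finset.sum_sub_distrib, Finset.sum_ite_eq', Finset.sum_const,
    nsmul_eq_mul, mul_one_div]

theorem edgeFlow_antisymm (G : SimpleGraph V) (f : V → ℝ) (u w : V) :
    edgeFlow G f w u = -edgeFlow G f u w := by
  by_cases h : G.Adj u w
  · simp [edgeFlow, h, h.symm]
  · simp [edgeFlow, h, mt SimpleGraph.Adj.symm h]

theorem edgeFlow_neg (G : SimpleGraph V) (f : V → ℝ) (u w : V) :
    edgeFlow G (-f) u w = -edgeFlow G f u w := by
  simp only [edgeFlow, Pi.neg_apply]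
  split_ifs <;> ring

theorem flowEnergy_edgeFlow [Fintype V] (G : SimpleGraph V) (f : V → ℝ) :
    flowEnergy (edgeFlow G f) = ∑ u, f u * ∑ w, edgeFlow G f u w := by
  have hsq : ∀ u w,
      edgeFlow G f u w ^ 2 = f u * edgeFlow G f u w + f w * edgeFlow G f w u := fun u w => by
    rw [edgeFlow_antisymm G f u w]
    unfold edgeFlow
    split_ifs <;> ring
  simp_rw [flowEnergy, hsq, Finset.sum_add_distrib, Finset.mul_sum]
  rw [Finset.sum_comm (f := fun u w => f w * edgeFlow G f w u)]
  ring

theorem mul_edgeCount_le_sum_edgeFlow [Fintype V] (G : SimpleGraph V) (f : V → ℝ) {A C : Finset V}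
    (hA : ∀ u ∈ A, ∀ w ∉ A, f w ≤ f u) (hAC : Disjoint A C) {s : ℝ}
    (hs : ∀ u ∈ A, ∀ w ∈ C, s ≤ f u - f w) :
    s * edgeCount G A C ≤ ∑ u ∈ A, ∑ w, edgeFlow G f u w := by
  classical
  have hcount : s * edgeCount G A C = ∑ u ∈ A, ∑ w ∈ C, if G.Adj u w then s else 0 := by
    rw [← Finset.sum_product', ← Finset.sum_filter, Finset.sum_const, nsmul_eq_mul, mul_comm]
    unfold edgeCount SimpleGraph.interedges Rel.interedges
    congr!
  have hcross : ∑ u ∈ A, ∑ w, edgeFlow G f u w = ∑ u ∈ A, ∑ w ∈ Aᶜ, edgeFlow G f u w := by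
    simp_rw [← Finset.sum_add_sum_compl A, Finset.sum_add_distrib,
      sum_sum_eq_zero_of_antisymm (edgeFlow_antisymm G f), zero_add]
  rw [hcount, hcross]
  refine Finset.sum_le_sum fun u hu => ?_
  calc ∑ w ∈ C, (if G.Adj u w then s else 0)
      ≤ ∑ w ∈ C, edgeFlow G f u w := Finset.sum_le_sum fun w hw => by
        unfold edgeFlow
        split_ifs
        exacts [hs u hu w hw, le_rfl]
    _ ≤ ∑ w ∈ Aᶜ, edgeFlow G f u w :=
        Finset.sum_le_sum_of_subset_of_nonneg
          (Finset.subset_compl_iff_disjoint_left.2 hAC) fun w hw _ => by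
          unfold edgeFlow
          split_ifs
          exacts [sub_nonneg.2 (hA u hu w (Finset.mem_compl.1 hw)), le_rfl]

theorem edgeCount_pos_iff {G : SimpleGraph V} {A C : Finset V} :
    0 < edgeCount G A C ↔ ∃ u ∈ A, ∃ w ∈ C, G.Adj u w := by
  classical
  rw [edgeCount, Finset.card_pos]
  exact ⟨fun ⟨p, hp⟩ => have h := Rel.mem_interedges_iff.1 hp; ⟨p.1, h.1, p.2, h.2.1, h.2.2⟩,
    fun ⟨u, hu, w, hw, h⟩ => ⟨(u, w), Rel.mem_interedges_iff.2 ⟨hu, hw, h⟩⟩⟩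

theorem edgeCount_compl_pos [Fintype V] [DecidableEq V] {G : SimpleGraph V} (hG : G.Connected)
    {A : Finset V} (hA : A.Nonempty) (hA' : Aᶜ.Nonempty) : 0 < edgeCount G A Aᶜ := by
  obtain ⟨u, hu⟩ := hA
  obtain ⟨w, hw⟩ := hA'
  obtain ⟨p⟩ := hG.preconnected u w
  obtain ⟨d, -, hfst, hsnd⟩ :=
    p.exists_boundary_dart (A : Set V) hu fun h => Finset.mem_compl.1 hw h
  exact edgeCount_pos_iff.2 ⟨d.fst, hfst, d.snd, Finset.mem_compl.2 hsnd, d.adj⟩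

theorem connected_of_forall_exists_adj [Fintype V] [Nonempty V] {G : SimpleGraph V}
    (hG : ∀ S : Finset V, S.Nonempty → S.card ≤ Fintype.card V / 2 →
      ∃ u ∈ S, ∃ w ∉ S, G.Adj u w) : G.Connected := by
  classical
  refine ⟨fun u w => ?_⟩
  by_contra huw
  set S : Finset V := {x | G.Reachable u x} with hS
  have hclosed : ∀ x ∈ S, ∀ y ∉ S, ¬G.Adj x y := fun x hx y hy hxy => by
    simp only [hS, Finset.mem_filter_univ] at hx hy
    exact hy (hx.trans hxy.reachable)
  rcases le_or_gt S.card (Fintype.card V / 2) with h | h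
  · obtain ⟨x, hx, y, hy, hxy⟩ := hG S ⟨u, by simp [hS]⟩ h
    exact hclosed x hx y hy hxy
  · obtain ⟨x, hx, y, hy, hxy⟩ :=
      hG Sᶜ ⟨w, by simpa [hS] using huw⟩ (by rw [Finset.card_compl]; omega)
    exact hclosed y (by simpa using hy) x (Finset.mem_compl.1 hx) hxy.symm

-- Adding the all-ones matrix makes the Laplacian invertible without changing it on potentials of
-- mean zero.
theorem exists_edgeFlow_sum_eq [Fintype V] {G : SimpleGraph V} (hG : G.Connected) (b : V → ℝ)
    (hb : ∑ u, b u = 0) : ∃ f : V → ℝ, ∀ u, ∑ w, edgeFlow G f u w = b u := by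
  classical
  have := hG.nonempty
  have hcard : (Fintype.card V : ℝ) ≠ 0 := Nat.cast_ne_zero.2 Fintype.card_ne_zero
  set M : Matrix V V ℝ := G.lapMatrix ℝ + Matrix.of fun _ _ => 1 with hM
  have hlap : ∀ f u, (G.lapMatrix ℝ).mulVec f u = ∑ w, edgeFlow G f u w := fun f u => by
    simp only [G.lapMatrix_mulVec_apply, edgeFlow, ← Finset.sum_filter,
      ← G.neighborFinset_eq_filter, Finset.sum_sub_distrib, Finset.sum_const, nsmul_eq_mul,
      G.card_neighborFinset_eq_degree]
  have hMf : ∀ f u, M.mulVec f u = ∑ w, edgeFlow G f u w + ∑ w, f w := fun f u => by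
    rw [hM, Matrix.add_mulVec, Pi.add_apply, hlap]
    simp [Matrix.mulVec, dotProduct]
  have hmean : ∀ f, ∑ u, M.mulVec f u = 0 → ∑ w, f w = 0 := fun f hf => by
    simpa only [hMf, Finset.sum_add_distrib, sum_sum_eq_zero_of_antisymm (edgeFlow_antisymm G f),
      zero_add, Finset.sum_const, Finset.card_univ, nsmul_eq_mul, mul_eq_zero, hcard,
      false_or] using hf
  have hinj : Function.Injective M.mulVec := by
    rw [← Matrix.coe_mulVecLin, injective_iff_map_eq_zero]
    intro f (hf : M.mulVec f = 0)
    have hf0 : ∑ w, f w = 0 := hmean f (by simp [hf])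
    have hker : (G.lapMatrix ℝ).mulVec f = 0 := funext fun u => by
      simpa [hf, hf0, hlap] using (hMf f u).symm
    have hconst : ∀ u w, f u = f w := fun u w =>
      G.lapMatrix_mulVec_eq_zero_iff_forall_reachable.1 hker u w (hG.preconnected u w)
    ext u
    simpa [fun w => hconst w u, hcard] using hf0
  obtain ⟨f, hf⟩ := Matrix.mulVec_surjective_iff_isUnit.2
    (Matrix.mulVec_injective_iff_isUnit.1 hinj) b
  refine ⟨f, fun u => ?_⟩
  have h := hMf f u
  rw [hf, hmean f (by rwa [hf]), add_zero] at h
  exact h.symm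

variable [Fintype V]

theorem exists_equiv_antitone (f : V → ℝ) :
    ∃ e : Fin (Fintype.card V) ≃ V, Antitone (f ∘ e) := by
  let e₀ := (Fintype.equivFin V).symm
  exact ⟨(Tuple.sort fun i => -f (e₀ i)).trans e₀,
    fun _ _ hij => neg_le_neg_iff.1 (Tuple.monotone_sort (fun i => -f (e₀ i)) hij)⟩

variable {G : SimpleGraph V} {f : V → ℝ} {e : Fin (Fintype.card V) ≃ V}

theorem sub_mul_edgeCount_le_sum_edgeFlow (he : Antitone (f ∘ e)) {a b : Fin (Fintype.card V)}
    (hab : a < b) :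
    (f (e a) - f (e b)) * edgeCount G ((Finset.Iic a).map e) ((Finset.Ici b).map e) ≤
      ∑ u ∈ (Finset.Iic a).map e, ∑ w, edgeFlow G f u w := by
  refine mul_edgeCount_le_sum_edgeFlow G f (fun u hu w hw => ?_)
    ((Finset.disjoint_map _).2 (Finset.disjoint_left.2 fun i hi hi' => ?_)) fun u hu w hw => ?_
  · obtain ⟨i, hi, rfl⟩ := Finset.mem_map.1 hu
    obtain ⟨j, rfl⟩ := e.surjective w
    have hj : a < j := not_le.1 fun h => hw (Finset.mem_map_of_mem _ (Finset.mem_Iic.2 h))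
    exact he ((Finset.mem_Iic.1 hi).trans hj.le)
  · exact ((Finset.mem_Iic.1 hi).trans_lt hab).not_ge (Finset.mem_Ici.1 hi')
  · obtain ⟨i, hi, rfl⟩ := Finset.mem_map.1 hu
    obtain ⟨j, hj, rfl⟩ := Finset.mem_map.1 hw
    exact sub_le_sub (he (Finset.mem_Iic.1 hi)) (he (Finset.mem_Ici.1 hj))

variable [DecidableEq V] {v : V}

theorem isSpreadingFlow_edgeFlow
    (hf : ∀ u, ∑ w, edgeFlow G f u w = (if u = v then 1 else 0) - 1 / (Fintype.card V : ℝ)) :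
    IsSpreadingFlow G v (edgeFlow G f) where
  antisymm := edgeFlow_antisymm G f
  eq_zero_of_not_adj _ _ h := if_neg h
  sum_eq := hf

theorem exists_isSpreadingFlow_edgeFlow (hG : G.Connected) (v : V) :
    ∃ f, IsSpreadingFlow G v (edgeFlow G f) := by
  have := hG.nonempty
  have hcard : (Fintype.card V : ℝ) ≠ 0 := Nat.cast_ne_zero.2 Fintype.card_ne_zero
  obtain ⟨f, hf⟩ := exists_edgeFlow_sum_eq hG
    (fun u => (if u = v then 1 else 0) - 1 / (Fintype.card V : ℝ)) (by simp [hcard])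
  exact ⟨f, isSpreadingFlow_edgeFlow hf⟩

theorem IsSpreadingFlow.flowEnergy_edgeFlow_eq (hf : IsSpreadingFlow G v (edgeFlow G f)) :
    flowEnergy (edgeFlow G f) = (∑ u, (f v - f u)) / Fintype.card V := by
  have hcard : (Fintype.card V : ℝ) ≠ 0 := Nat.cast_ne_zero.2 (Fintype.card_pos_iff.2 ⟨v⟩).ne'
  rw [flowEnergy_edgeFlow]
  simp only [hf.sum_eq, mul_sub, Finset.sum_sub_distrib, mul_ite, mul_one, mul_zero,
    Finset.sum_ite_eq', Finset.mem_univ, if_true, ← Finset.sum_div, Finset.sum_const,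
    Finset.card_univ, nsmul_eq_mul, sub_div, mul_div_cancel_left₀ _ hcard, mul_one_div]

theorem IsSpreadingFlow.flowEnergy_edgeFlow_le (hf : IsSpreadingFlow G v (edgeFlow G f)) {B : ℝ}
    (hB : ∀ u, f v - f u ≤ B) : flowEnergy (edgeFlow G f) ≤ B := by
  have hcard : (0 : ℝ) < Fintype.card V := Nat.cast_pos.2 (Fintype.card_pos_iff.2 ⟨v⟩)
  rw [hf.flowEnergy_edgeFlow_eq, div_le_iff₀ hcard, mul_comm]
  simpa using Finset.sum_le_sum fun u (_ : u ∈ Finset.univ) => hB u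

theorem exists_isSpreadingFlow_top (v : V) :
    ∃ g, IsSpreadingFlow (⊤ : SimpleGraph V) v g ∧ flowEnergy g ≤ 1 / Fintype.card V := by
  have hcard : (Fintype.card V : ℝ) ≠ 0 := Nat.cast_ne_zero.2 (Fintype.card_pos_iff.2 ⟨v⟩).ne'
  set f : V → ℝ := fun u => if u = v then 1 / (Fintype.card V : ℝ) else 0 with hf
  have hflow : ∀ u w, edgeFlow ⊤ f u w = f u - f w := fun u w => by
    rcases eq_or_ne u w with rfl | h <;> simp [edgeFlow, *]
  have hspread : IsSpreadingFlow ⊤ v (edgeFlow ⊤ f) := isSpreadingFlow_edgeFlow fun u => by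
    simp only [hflow, Finset.sum_sub_distrib, Finset.sum_const, Finset.card_univ, nsmul_eq_mul]
    simp only [hf, Finset.sum_ite_eq', Finset.mem_univ, if_true, mul_ite, mul_zero,
      mul_one_div_cancel hcard]
  refine ⟨_, hspread, hspread.flowEnergy_edgeFlow_le fun u => ?_⟩
  have : 0 ≤ f u := by simp only [hf]; positivity
  simp only [hf, if_true] at this ⊢
  linarith

end Flow

section Connected

variable {V : Type*} [Fintype V] [DecidableEq V] {G : SimpleGraph V} {f : V → ℝ} {v : V}
  {e : Fin (Fintype.card V) ≃ V}

theorem IsSpreadingFlow.potential_sub_succ_le (hf : IsSpreadingFlow G v (edgeFlow G f))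
    (hG : G.Connected) (he : Antitone (f ∘ e)) {i : ℕ} (hi : i + 1 < Fintype.card V) :
    f (e ⟨i, by omega⟩) - f (e ⟨i + 1, hi⟩) ≤ 1 - ((i : ℝ) + 1) / Fintype.card V := by
  set a : Fin (Fintype.card V) := ⟨i, by omega⟩ with ha
  set b : Fin (Fintype.card V) := ⟨i + 1, hi⟩ with hb
  have hab : a < b := Nat.lt_succ_self i
  have hcompl : (Finset.Ici b).map e.toEmbedding = ((Finset.Iic a).map e.toEmbedding)ᶜ := by
    ext u
    obtain ⟨j, rfl⟩ := e.surjective u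
    simp [ha, hb, Fin.le_def]
  have hcount : (1 : ℝ) ≤
      edgeCount G ((Finset.Iic a).map e.toEmbedding) ((Finset.Ici b).map e.toEmbedding) := by
    rw [hcompl]
    exact_mod_cast edgeCount_compl_pos hG (by simp) (by rw [← hcompl]; simp)
  have hcard : (((Finset.Iic a).map e.toEmbedding).card : ℝ) = i + 1 := by simp [ha]
  have hflow := sub_mul_edgeCount_le_sum_edgeFlow (G := G) he hab
  rw [hf.sum_sum_eq, hcard] at hflow
  refine (le_mul_of_one_le_right (sub_nonneg.2 (he hab.le)) hcount).trans (hflow.trans ?_)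
  gcongr
  split_ifs <;> norm_num

theorem IsSpreadingFlow.potential_sub_le (hf : IsSpreadingFlow G v (edgeFlow G f))
    (hG : G.Connected) (he : Antitone (f ∘ e)) {k : ℕ} (hk : k < Fintype.card V) :
    f (e ⟨0, by omega⟩) - f (e ⟨k, hk⟩) ≤ k - (k : ℝ) * (k + 1) / (2 * Fintype.card V) := by
  induction k with
  | zero => simp
  | succ k ih =>
    have hm : (Fintype.card V : ℝ) ≠ 0 := Nat.cast_ne_zero.2 (by omega)
    calc f (e ⟨0, by omega⟩) - f (e ⟨k + 1, hk⟩)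
        = f (e ⟨0, by omega⟩) - f (e ⟨k, by omega⟩) +
          (f (e ⟨k, by omega⟩) - f (e ⟨k + 1, hk⟩)) := by ring
      _ ≤ k - (k : ℝ) * (k + 1) / (2 * Fintype.card V) +
          (1 - ((k : ℝ) + 1) / Fintype.card V) :=
        add_le_add (ih _) (hf.potential_sub_succ_le hG he hk)
      _ = _ := by push_cast; field_simp; ring

theorem sum_range_sub_mul_succ_div {m : ℝ} (hm : m ≠ 0) (j : ℕ) :
    ∑ k ∈ Finset.range j, ((k : ℝ) - (k : ℝ) * (k + 1) / (2 * m)) =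
      (j : ℝ) * (j - 1) / 2 - ((j : ℝ) - 1) * j * (j + 1) / (6 * m) := by
  induction j with
  | zero => simp
  | succ j ih => rw [Finset.sum_range_succ, ih]; push_cast; field_simp; ring

theorem exists_isSpreadingFlow_of_connected (hG : G.Connected) (v : V) :
    ∃ g, IsSpreadingFlow G v g ∧ flowEnergy g ≤ (Fintype.card V : ℝ) / 3 := by
  have hpos : 0 < Fintype.card V := Fintype.card_pos_iff.2 ⟨v⟩
  obtain ⟨f, hf⟩ := exists_isSpreadingFlow_edgeFlow hG v
  set m := Fintype.card V
  obtain ⟨e, he⟩ : ∃ e : Fin m ≃ V, Antitone (f ∘ e) := exists_equiv_antitone f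
  have hm : (0 : ℝ) < m := Nat.cast_pos.2 hpos
  have hm1 : (1 : ℝ) ≤ m := Nat.one_le_cast.2 hpos
  have hv : f v ≤ f (e ⟨0, hpos⟩) := by
    simpa using he (Fin.mk_le_of_le_val (Nat.zero_le (e.symm v : ℕ)))
  have hsum : ∑ u, (f v - f u) ≤ (m : ℝ) * (m - 1) / 2 - ((m : ℝ) - 1) * m * (m + 1) / (6 * m) :=
    calc ∑ u, (f v - f u) ≤ ∑ u, (f (e ⟨0, hpos⟩) - f u) := by gcongr
      _ = ∑ k : Fin m, (f (e ⟨0, hpos⟩) - f (e k)) := (e.sum_comp _).symm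
      _ ≤ ∑ k : Fin m, (((k : ℕ) : ℝ) - (k : ℕ) * ((k : ℕ) + 1) / (2 * m)) :=
        Finset.sum_le_sum fun k _ => hf.potential_sub_le hG he k.isLt
      _ = _ := by
        rw [Fin.sum_univ_eq_sum_range (fun k => (k : ℝ) - k * (k + 1) / (2 * m)),
          sum_range_sub_mul_succ_div hm.ne']
  refine ⟨_, hf, ?_⟩
  rw [hf.flowEnergy_edgeFlow_eq, div_le_iff₀ hm]
  refine hsum.trans ?_
  rw [mul_assoc, mul_left_comm, mul_comm (6 : ℝ), mul_div_mul_left _ _ hm.ne']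
  nlinarith

end Connected

section Expanding

variable {V : Type*} [Fintype V] {G : SimpleGraph V}

/-- Every small set `A` has at least its share, up to the factor `τ`, of the edges to each disjoint
set `C` of a prescribed size. The sizes are those met when the level sets of a potential are
repeatedly doubled, up to half of the vertices. -/
def IsExpanding (G : SimpleGraph V) (τ : ℝ) : Prop :=
  ∀ A C : Finset V, Disjoint A C → 1 ≤ A.card → A.card ≤ Fintype.card V / 2 →
    C.card = Fintype.card V - min (2 * A.card - 1) (Fintype.card V / 2) →
    τ * A.card * C.card / Fintype.card V ≤ edgeCount G A C

variable {τ : ℝ}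

theorem IsExpanding.edgeCount_pos (hG : IsExpanding G τ) (hτ : 0 < τ) {A C : Finset V}
    (hAC : Disjoint A C) (hA : A.Nonempty) (hA' : A.card ≤ Fintype.card V / 2)
    (hC : C.card = Fintype.card V - min (2 * A.card - 1) (Fintype.card V / 2)) :
    0 < edgeCount G A C := by
  have hA1 : 0 < A.card := Finset.card_pos.2 hA
  have hC1 : 0 < C.card := by omega
  have hV : 0 < Fintype.card V := by omega
  exact Nat.cast_pos.1 ((by positivity : 0 < τ * A.card * C.card / Fintype.card V).trans_le
    (hG A C hAC hA1 hA' hC))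

theorem IsExpanding.connected [Nonempty V] (hG : IsExpanding G τ) (hτ : 0 < τ) :
    G.Connected := by
  classical
  refine connected_of_forall_exists_adj fun S hS hcard => ?_
  obtain ⟨C, hCS, hC⟩ := Finset.exists_subset_card_eq
    (show Fintype.card V - min (2 * S.card - 1) (Fintype.card V / 2) ≤ Sᶜ.card by
      have := Finset.card_pos.2 hS
      rw [Finset.card_compl]
      omega)
  have hSC : Disjoint S C := Finset.subset_compl_iff_disjoint_left.1 hCS
  obtain ⟨u, hu, w, hw, h⟩ := edgeCount_pos_iff.1 (hG.edgeCount_pos hτ hSC hS hcard hC)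
  exact ⟨u, hu, w, Finset.mem_compl.1 (hCS hw), h⟩

theorem sub_le_of_sum_edgeFlow_le {f : V → ℝ} {e : Fin (Fintype.card V) ≃ V}
    (he : Antitone (f ∘ e)) {D : ℝ} (hD : 0 ≤ D) {j : ℕ}
    (h : ∀ A C : Finset V, Disjoint A C → A.card = 2 ^ j → 2 ^ j ≤ Fintype.card V / 2 →
      C.card = Fintype.card V - min (2 * 2 ^ j - 1) (Fintype.card V / 2) →
      0 < edgeCount G A C ∧ ∑ u ∈ A, ∑ w, edgeFlow G f u w ≤ D * edgeCount G A C)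
    {a b : Fin (Fintype.card V)} (ha : (a : ℕ) = min (2 ^ j - 1) (Fintype.card V / 2))
    (hb : (b : ℕ) = min (2 ^ (j + 1) - 1) (Fintype.card V / 2)) :
    f (e a) - f (e b) ≤ D := by
  rw [pow_succ'] at hb
  have hj : 0 < 2 ^ j := Nat.two_pow_pos j
  rcases (show a ≤ b from Fin.le_def.2 (by omega)).eq_or_lt with rfl | hab
  · simpa using hD
  have : (a : ℕ) < b := hab
  have hdisj : Disjoint ((Finset.Iic a).map e.toEmbedding) ((Finset.Ici b).map e.toEmbedding) :=
    (Finset.disjoint_map _).2 (Finset.disjoint_left.2 fun i hi hi' =>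
      ((Finset.mem_Iic.1 hi).trans_lt hab).not_ge (Finset.mem_Ici.1 hi'))
  obtain ⟨hpos, hle⟩ := h _ _ hdisj (by rw [Finset.card_map, Fin.card_Iic]; omega) (by omega)
    (by rw [Finset.card_map, Fin.card_Ici]; omega)
  exact le_of_mul_le_mul_right ((sub_mul_edgeCount_le_sum_edgeFlow he hab).trans hle)
    (Nat.cast_pos.2 hpos)

-- Climbing from the median to the top: the upper level sets of size `2 ^ j` and `2 ^ (j + 1)` are
-- separated by a potential drop of at most `D j`.
theorem exists_le_add_sum_of_sum_edgeFlow_le [Nonempty V] (f : V → ℝ) {D : ℕ → ℝ}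
    (hD : ∀ j, 0 ≤ D j)
    (h : ∀ j, ∀ A C : Finset V, Disjoint A C → A.card = 2 ^ j → 2 ^ j ≤ Fintype.card V / 2 →
      C.card = Fintype.card V - min (2 * 2 ^ j - 1) (Fintype.card V / 2) →
      0 < edgeCount G A C ∧ ∑ u ∈ A, ∑ w, edgeFlow G f u w ≤ D j * edgeCount G A C) :
    ∃ t, (∀ u, f u ≤ t + ∑ j ∈ Finset.range (Nat.log 2 (Fintype.card V)), D j) ∧
      Fintype.card V / 2 < (Finset.univ.filter fun u => t ≤ f u).card := by
  have hm : 0 < Fintype.card V := Fintype.card_pos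
  set m := Fintype.card V
  obtain ⟨e, he⟩ : ∃ e : Fin m ≃ V, Antitone (f ∘ e) := exists_equiv_antitone f
  have hhalf : m / 2 < m := Nat.div_lt_self hm one_lt_two
  set r : ℕ → Fin m := fun j => ⟨min (2 ^ j - 1) (m / 2), by omega⟩ with hr
  have hclimb : ∀ j, f (e (r 0)) - f (e (r j)) ≤ ∑ i ∈ Finset.range j, D i := fun j => by
    induction j with
    | zero => simp
    | succ j ih =>
      rw [Finset.sum_range_succ, ← sub_add_sub_cancel _ (f (e (r j)))]
      exact add_le_add ih (sub_le_of_sum_edgeFlow_le he (hD j) (h j) rfl rfl)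
  have hlog : r (Nat.log 2 m) = ⟨m / 2, hhalf⟩ := by
    have := Nat.lt_pow_succ_log_self one_lt_two m
    rw [pow_succ] at this
    exact Fin.ext (min_eq_right (by omega))
  refine ⟨f (e ⟨m / 2, hhalf⟩), fun u => ?_, ?_⟩
  · have hu : f u ≤ f (e (r 0)) := by
      simpa using he (show r 0 ≤ e.symm u from Fin.le_def.2 (by simp [hr]))
    rw [← hlog]
    linarith [hclimb (Nat.log 2 m)]
  · calc m / 2 < ((Finset.Iic (⟨m / 2, hhalf⟩ : Fin m)).map e.toEmbedding).card := by simp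
      _ ≤ _ := Finset.card_le_card fun u hu => by
        obtain ⟨i, hi, rfl⟩ := Finset.mem_map.1 hu
        exact (Finset.mem_filter_univ _).2 (he (Finset.mem_Iic.1 hi))

theorem IsExpanding.exists_le_add_sum [Nonempty V] (hG : IsExpanding G τ) (hτ : 0 < τ) (f : V → ℝ)
    {D : ℕ → ℝ} (hD : ∀ j, 0 ≤ D j)
    (h : ∀ (j : ℕ) (A : Finset V) (c : ℝ), A.card = 2 ^ j → 2 ^ j ≤ (Fintype.card V : ℝ) / 2 →
      (Fintype.card V : ℝ) ≤ 2 * c → (Fintype.card V : ℝ) - 2 * 2 ^ j ≤ c →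
      ∑ u ∈ A, ∑ w, edgeFlow G f u w ≤ D j * (τ * 2 ^ j * c / Fintype.card V)) :
    ∃ t, (∀ u, f u ≤ t + ∑ j ∈ Finset.range (Nat.log 2 (Fintype.card V)), D j) ∧
      Fintype.card V / 2 < (Finset.univ.filter fun u => t ≤ f u).card := by
  refine exists_le_add_sum_of_sum_edgeFlow_le (G := G) f hD fun j A C hAC hA hj hC => ?_
  have hj0 : 0 < 2 ^ j := Nat.two_pow_pos j
  rw [← hA] at hj hC
  refine ⟨hG.edgeCount_pos hτ hAC (Finset.card_pos.1 (hA ▸ hj0)) hj hC, ?_⟩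
  have hshare := hG A C hAC (hA ▸ hj0) hj hC
  have hj' : (2 ^ j : ℝ) ≤ Fintype.card V / 2 := by
    rw [le_div_iff₀ two_pos]
    exact_mod_cast (by omega : 2 ^ j * 2 ≤ Fintype.card V)
  rw [hA, Nat.cast_pow, Nat.cast_ofNat] at hshare
  refine (h j A C.card hA hj' ?_ ?_).trans (mul_le_mul_of_nonneg_left hshare (hD j))
  · exact_mod_cast (by omega : Fintype.card V ≤ 2 * C.card)
  · rw [sub_le_iff_le_add]
    exact_mod_cast (by omega : Fintype.card V ≤ C.card + 2 * 2 ^ j)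

variable [DecidableEq V] {v : V} {f : V → ℝ}

theorem IsSpreadingFlow.exists_le_add_of_isExpanding (hf : IsSpreadingFlow G v (edgeFlow G f))
    (hτ : 0 < τ) (hG : IsExpanding G τ) :
    ∃ t, (∀ u, f u ≤ t + (2 / τ + 4 * Nat.log 2 (Fintype.card V) / (τ * Fintype.card V))) ∧
      Fintype.card V / 2 < (Finset.univ.filter fun u => t ≤ f u).card := by
  have : Nonempty V := ⟨v⟩
  have : (0 : ℝ) < Fintype.card V := Nat.cast_pos.2 Fintype.card_pos
  obtain ⟨t, ht, hcard⟩ := hG.exists_le_add_sum hτ f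
    (D := fun j => ((1 / 2) ^ j + 4 / Fintype.card V) / τ) (fun j => by positivity)
    fun j A c _ hj hc hc' => by
      have hA : ∑ u ∈ A, ∑ w, edgeFlow G f u w ≤ 1 := by
        rw [hf.sum_sum_eq]
        refine (sub_le_self _ (by positivity)).trans ?_
        split_ifs <;> norm_num
      refine hA.trans ?_
      have ha : (0 : ℝ) < 2 ^ j := by positivity
      rw [one_div_pow]
      set a : ℝ := 2 ^ j
      have hbudget : (1 / a + 4 / Fintype.card V) / τ * (τ * a * c / Fintype.card V) =
          (Fintype.card V + 4 * a) * c / (Fintype.card V : ℝ) ^ 2 := by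
        field_simp
      rw [hbudget, one_le_div (by positivity)]
      nlinarith
  refine ⟨t, fun u => (ht u).trans (add_le_add_right ?_ t), hcard⟩
  have hgeom := sum_geometric_two_le (Nat.log 2 (Fintype.card V))
  rw [← Finset.sum_div, Finset.sum_add_distrib, Finset.sum_const, Finset.card_range, nsmul_eq_mul,
    add_div, mul_div_assoc', div_div, mul_comm (_ : ℝ) 4, mul_comm τ]
  gcongr

theorem IsSpreadingFlow.exists_neg_le_add_of_isExpanding
    (hf : IsSpreadingFlow G v (edgeFlow G f)) (hτ : 0 < τ) (hG : IsExpanding G τ) :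
    ∃ t, (∀ u, -f u ≤ t + 2 * Nat.log 2 (Fintype.card V) / (τ * Fintype.card V)) ∧
      Fintype.card V / 2 < (Finset.univ.filter fun u => t ≤ -f u).card := by
  have : Nonempty V := ⟨v⟩
  have hm : (0 : ℝ) < Fintype.card V := Nat.cast_pos.2 Fintype.card_pos
  obtain ⟨t, ht, hcard⟩ := hG.exists_le_add_sum hτ (-f)
    (D := fun _ => 2 / (τ * Fintype.card V)) (fun _ => by positivity)
    fun j A c hA _ hc _ => by
      have hA : ∑ u ∈ A, ∑ w, edgeFlow G (-f) u w ≤ 2 ^ j / Fintype.card V := by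
        simp only [edgeFlow_neg, Finset.sum_neg_distrib]
        rw [hf.sum_sum_eq, hA]
        push_cast
        split_ifs <;> linarith
      refine hA.trans ?_
      have hbudget : 2 / (τ * Fintype.card V) * (τ * 2 ^ j * c / Fintype.card V) =
          2 ^ j * (2 * c) / (Fintype.card V * Fintype.card V) := by
        field_simp
      rw [hbudget, div_le_div_iff₀ hm (by positivity), mul_assoc]
      gcongr
  refine ⟨t, fun u => (ht u).trans_eq ?_, hcard⟩
  rw [Finset.sum_const, Finset.card_range, nsmul_eq_mul, mul_div_assoc', mul_comm (_ : ℝ) 2]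

theorem exists_isSpreadingFlow_of_isExpanding (hτ : 0 < τ) (hG : IsExpanding G τ) (v : V) :
    ∃ g, IsSpreadingFlow G v g ∧
      flowEnergy g ≤ 2 / τ + 6 * Nat.log 2 (Fintype.card V) / (τ * Fintype.card V) := by
  have : Nonempty V := ⟨v⟩
  obtain ⟨f, hf⟩ := exists_isSpreadingFlow_edgeFlow (hG.connected hτ) v
  obtain ⟨t, ht, hcard⟩ := hf.exists_le_add_of_isExpanding hτ hG
  obtain ⟨s, hs, hcard'⟩ := hf.exists_neg_le_add_of_isExpanding hτ hG
  obtain ⟨u, hu⟩ := Finset.inter_nonempty_of_card_lt_card_add_card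
    (Finset.subset_univ (Finset.univ.filter fun u => t ≤ f u))
    (Finset.subset_univ (Finset.univ.filter fun u => s ≤ -f u))
    (by rw [Finset.card_univ]; omega)
  simp only [Finset.mem_inter, Finset.mem_filter_univ] at hu
  refine ⟨_, hf, hf.flowEnergy_edgeFlow_le fun w => ?_⟩
  have hsplit : 6 * (Nat.log 2 (Fintype.card V) : ℝ) / (τ * Fintype.card V) =
      4 * Nat.log 2 (Fintype.card V) / (τ * Fintype.card V) +
        2 * Nat.log 2 (Fintype.card V) / (τ * Fintype.card V) := by ring
  linarith [ht v, hs w, hu.1, hu.2]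

end Expanding

section Shift

variable {n : ℕ} {g : Fin n → Fin n → ℝ}

/-- The shift of the pairwise draws that changes every `Δ_{u,v}` by `g u v`, for an antisymmetric
`g` that vanishes outside the edges. -/
def pairShift (g : Fin n → Fin n → ℝ) (e : Sym2 (Fin n)) : ℝ :=
  Sym2.lift ⟨fun u w => if u < w then g u w else g w u, fun u w => by
    rcases lt_trichotomy u w with h | rfl | h
    · simp [h, h.not_gt]
    · rfl
    · simp [h, h.not_gt]⟩ e

theorem pairShift_of_lt (g : Fin n → Fin n → ℝ) {u w : Fin n} (h : u < w) :
    pairShift g s(u, w) = g u w :=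
  if_pos h

theorem pairShift_of_not_lt (g : Fin n → Fin n → ℝ) {u w : Fin n} (h : ¬u < w) :
    pairShift g s(u, w) = g w u :=
  if_neg h

theorem sum_sum_eq_two_mul_sum_lt {ι : Type*} [Fintype ι] [LinearOrder ι] {F : ι → ι → ℝ}
    (hsymm : ∀ u w, F u w = F w u) (hdiag : ∀ u, F u u = 0) :
    ∑ u, ∑ w, F u w = 2 * ∑ u, ∑ w, if u < w then F u w else 0 := by
  have hsplit : ∀ u w, F u w = (if u < w then F u w else 0) + if w < u then F w u else 0 :=
    fun u w => by
      rcases lt_trichotomy u w with h | rfl | h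
      · simp [h, h.not_gt]
      · simp [hdiag]
      · simp [h, h.not_gt, hsymm u w]
  rw [Finset.sum_congr rfl fun u _ => Finset.sum_congr rfl fun w _ => hsplit u w]
  simp_rw [Finset.sum_add_distrib]
  rw [Finset.sum_comm (f := fun u w => if w < u then F w u else 0), two_mul]

theorem sum_pairShift_sq (hg : ∀ u w, g w u = -g u w) : ∑ e, pairShift g e ^ 2 = flowEnergy g := by
  have hdiag : ∀ u, g u u = 0 := fun u => by linarith [hg u u]
  have hpair : ∑ e, pairShift g e ^ 2 = ∑ u, ∑ w, if u < w then g u w ^ 2 else 0 :=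
    calc ∑ e, pairShift g e ^ 2
        = ∑ e ∈ (Finset.univ : Finset (Fin n)).sym2 with ¬e.IsDiag, pairShift g e ^ 2 := by
          rw [Finset.sym2_univ]
          refine (Finset.sum_filter_of_ne (p := fun e : Sym2 (Fin n) => ¬e.IsDiag)
            fun e _ he hd => he ?_).symm
          induction e with
          | _ u w =>
            obtain rfl : u = w := by simpa using hd
            rw [pairShift_of_not_lt g (lt_irrefl u), hdiag, zero_pow two_ne_zero]
      _ = ∑ p ∈ (Finset.univ : Finset (Fin n)).offDiag with p.1 < p.2,
            pairShift g s(p.1, p.2) ^ 2 := Finset.sum_sym2_filter_not_isDiag _ _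
      _ = ∑ p : Fin n × Fin n with p.1 < p.2, g p.1 p.2 ^ 2 := by
          refine Finset.sum_congr ?_ fun p hp => by
            rw [pairShift_of_lt g (Finset.mem_filter.1 hp).2]
          ext p
          simpa using fun h : p.1 < p.2 => h.ne
      _ = _ := by rw [Finset.sum_filter, Fintype.sum_prod_type]
  rw [hpair, flowEnergy, sum_sum_eq_two_mul_sum_lt (F := fun u w => g u w ^ 2)
    (fun u w => by rw [hg u w, neg_sq]) fun u => by rw [hdiag, zero_pow two_ne_zero]]
  ring

variable {G : SimpleGraph (Fin n)} {H : Finset (Fin n)}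

theorem pairNoise_merge_add (hg : ∀ u w, g w u = -g u w)
    (hsupp : ∀ u w, ¬(u ∈ H ∧ w ∈ H ∧ G.Adj u w) → g u w = 0) (s : Fin n → ℝ) (ω α : Noise n)
    (u w : Fin n) :
    pairNoise G (merge H (ω + (s, pairShift g)) α) u w =
      pairNoise G (merge H ω α) u w + g u w := by
  by_cases hadj : G.Adj u w
  · by_cases hH : u ∈ H ∧ w ∈ H
    · have hmem : ∀ x ∈ s(u, w), x ∈ H := by simpa using hH
      simp only [pairNoise, hadj, if_true, merge, if_pos hmem, Prod.snd_add, Pi.add_apply]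
      split_ifs with hlt
      · rw [pairShift_of_lt g hlt]
      · rw [pairShift_of_not_lt g hlt, hg u w, neg_add, neg_neg]
    · have hmem : ¬∀ x ∈ s(u, w), x ∈ H := by simpa using hH
      rw [hsupp u w fun h => hH ⟨h.1, h.2.1⟩, add_zero]
      simp only [pairNoise, hadj, if_true, merge, if_neg hmem]
  · rw [hsupp u w fun h => hadj h.2.2, add_zero]
    simp only [pairNoise, hadj, if_false]

theorem view_merge_add {X X' s : Fin n → ℝ} (hg : ∀ u w, g w u = -g u w)
    (hsupp : ∀ u w, ¬(u ∈ H ∧ w ∈ H ∧ G.Adj u w) → g u w = 0) (hmal : ∀ u ∉ H, X u = X' u)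
    (hhon : ∀ u ∈ H, X u = X' u + ∑ w, g u w + s u) (ω α : Noise n) :
    view G H X (merge H ω α) = view G H X' (merge H (ω + (s, pairShift g)) α) := by
  classical
  have hpair := pairNoise_merge_add hg hsupp s ω α
  refine Prod.ext rfl (Prod.ext (funext fun u => ?_) (Prod.ext (funext fun u => hmal u u.2)
    (Prod.ext (funext fun u => ?_) (funext fun p => ?_))))
  · have hsum : ∑ w ∈ G.neighborFinset u, g u w = ∑ w, g u w :=
      Finset.sum_subset (Finset.subset_univ _) fun w _ hw =>
        hsupp u w fun h => hw ((G.mem_neighborFinset u w).2 h.2.2)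
    simp only [view, noisyValue, hpair, Finset.sum_add_distrib, hsum]
    by_cases hu : u ∈ H
    · simp only [merge, hu, if_true, Prod.fst_add, Pi.add_apply, hhon u hu]
      ring
    · rw [Finset.sum_eq_zero fun w _ => hsupp u w fun h => hu h.1, hmal u hu, add_zero]
      simp only [merge, hu, if_false]
  · simp only [view, merge, u.2, if_false]
  · simp only [view, hpair]
    rw [hsupp p.1.1 p.1.2 fun h => p.2.elim (absurd h.1) (absurd h.2.1), add_zero]

/-- The shift of the honest draws that hides a change by `a` of one honest private value: the pair
noise moves the difference along the flow `a • g`, which leaves an equal share for the independent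
noise of each honest user. -/
noncomputable def spreadShift (H : Finset (Fin n)) (g : Fin n → Fin n → ℝ) (a : ℝ) : Noise n :=
  (fun u => if u ∈ H then a / H.card else 0, pairShift fun u w => a * g u w)

theorem spreadShift_cost (hg : ∀ u w, g w u = -g u w) (a varEta varDelta : ℝ) :
    (∑ u, (spreadShift H g a).1 u ^ 2) / varEta + (∑ e, (spreadShift H g a).2 e ^ 2) / varDelta =
      a ^ 2 * (1 / H.card / varEta + flowEnergy g / varDelta) := by
  have hsingle : ∑ u, (spreadShift H g a).1 u ^ 2 = a ^ 2 * (1 / H.card) := by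
    simp only [spreadShift, ite_pow, zero_pow two_ne_zero, Finset.sum_ite_mem, Finset.univ_inter,
      Finset.sum_const, nsmul_eq_mul]
    rcases eq_or_ne (H.card : ℝ) 0 with h | h
    · simp [h]
    · field_simp
  have hpair : ∑ e, (spreadShift H g a).2 e ^ 2 = a ^ 2 * flowEnergy g := by
    rw [spreadShift, sum_pairShift_sq fun u w => by rw [hg u w, mul_neg]]
    simp only [flowEnergy, mul_pow, ← Finset.mul_sum, mul_div_assoc]
  rw [hsingle, hpair]
  ring

theorem view_merge_add_spreadShift {v : Fin n} (hv : v ∈ H) (hg : ∀ u w, g w u = -g u w)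
    (hsupp : ∀ u w, ¬(u ∈ H ∧ w ∈ H ∧ G.Adj u w) → g u w = 0)
    (hsum : ∀ u ∈ H, ∑ w, g u w = (if u = v then 1 else 0) - 1 / (H.card : ℝ))
    {X X' : Fin n → ℝ} (hXX' : ∀ u, u ≠ v → X u = X' u) (ω α : Noise n) :
    view G H X (merge H ω α) = view G H X' (merge H (ω + spreadShift H g (X v - X' v)) α) := by
  refine view_merge_add (fun u w => by rw [hg u w, mul_neg])
    (fun u w h => by rw [hsupp u w h, mul_zero]) (fun u hu => hXX' u fun h => hu (h ▸ hv))
    (fun u hu => ?_) ω α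
  rw [← Finset.mul_sum, hsum u hu, if_pos hu]
  split_ifs with huv
  · rw [huv]; ring
  · rw [hXX' u huv]; ring

instance isProbabilityMeasure_protocolNoise (n : ℕ) (varEta varDelta : ℝ≥0) :
    IsProbabilityMeasure (protocolNoise n varEta varDelta) := by
  unfold protocolNoise; infer_instance

theorem gopa_le_of_view_merge_add {varEta varDelta : ℝ≥0} {h : Noise n} {X X' : Fin n → ℝ}
    (hview : ∀ ω α, view G H X (merge H ω α) = view G H X' (merge H (ω + h) α)) {a b : ℝ≥0∞}
    (hshift : ∀ S, MeasurableSet S → (protocolNoise n varEta varDelta).map (· + h) S ≤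
      a * protocolNoise n varEta varDelta S + b)
    (ν : ProbabilityMeasure (Noise n)) {O : Set (View n H)} (hO : MeasurableSet O) :
    gopa G H varEta varDelta ν X O ≤ a * gopa G H varEta varDelta ν X' O + b := by
  have hmX := measurable_view G H X
  have hmX' := measurable_view G H X'
  have hslice : ∀ α, MeasurableSet {ω | view G H X' (merge H ω α) ∈ O} := fun α =>
    (hmX'.comp (measurable_id.prodMk measurable_const)) hO
  rw [gopa, gopa, Measure.map_apply hmX hO, Measure.map_apply hmX' hO,
    Measure.prod_apply_symm (hmX hO), Measure.prod_apply_symm (hmX' hO)]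
  calc _ ≤ ∫⁻ α, (a * protocolNoise n varEta varDelta {ω | view G H X' (merge H ω α) ∈ O} + b)
          ∂(ν : Measure (Noise n)) := lintegral_mono fun α => by
        refine le_trans (le_of_eq ?_) (hshift _ (hslice α))
        rw [Measure.map_apply (by fun_prop) (hslice α)]
        congr 1
        ext ω
        simp only [Set.mem_preimage, Set.mem_ofPred_eq, hview]
    _ = _ := by
        rw [lintegral_add_right _ measurable_const, lintegral_const, measure_univ, mul_one]
        congr 1
        exact lintegral_const_mul a (measurable_measure_prodMk_right (hmX' hO))

theorem gopa_le_of_flow {v : Fin n} (hv : v ∈ H) (hg : ∀ u w, g w u = -g u w)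
    (hsupp : ∀ u w, ¬(u ∈ H ∧ w ∈ H ∧ G.Adj u w) → g u w = 0)
    (hsum : ∀ u ∈ H, ∑ w, g u w = (if u = v then 1 else 0) - 1 / (H.card : ℝ))
    {varEta varDelta : ℝ≥0} (hE : varEta ≠ 0) (hD : varDelta ≠ 0) {ε δ C : ℝ} (hε0 : 0 < ε)
    (hε1 : ε ≤ 1) (hδ0 : 0 < δ) (hC : 2 * Real.log (1.25 / δ) < C)
    (hq : (1 / H.card / varEta + flowEnergy g / varDelta) * C ≤ ε ^ 2)
    (ν : ProbabilityMeasure (Noise n)) {X X' : Fin n → ℝ}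
    (hX : ∀ u, X u ∈ Set.Icc (0 : ℝ) 1) (hX' : ∀ u, X' u ∈ Set.Icc (0 : ℝ) 1)
    (hXX' : ∀ u, u ≠ v → X u = X' u) {O : Set (View n H)} (hO : MeasurableSet O) :
    gopa G H varEta varDelta ν X O ≤
      ENNReal.ofReal (Real.exp ε) * gopa G H varEta varDelta ν X' O + ENNReal.ofReal δ := by
  have hdiff : (X v - X' v) ^ 2 ≤ 1 := by
    rw [sq_le_one_iff_abs_le_one, abs_le]
    constructor <;> linarith [(hX v).1, (hX v).2, (hX' v).1, (hX' v).2]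
  refine gopa_le_of_view_merge_add (view_merge_add_spreadShift hv hg hsupp hsum hXX')
    (fun S hS => protocolNoise_map_add_const_apply_le hE hD _ hε0 hε1 hδ0 hC ?_ hS) ν hO
  rw [spreadShift_cost hg, mul_assoc]
  calc (X v - X' v) ^ 2 * ((1 / H.card / varEta + flowEnergy g / varDelta) * C)
      ≤ (X v - X' v) ^ 2 * ε ^ 2 := by gcongr
    _ ≤ 1 * ε ^ 2 := by gcongr
    _ = ε ^ 2 := one_mul _

end Shift

section Extend

variable {V : Type*} {H : Finset V}

open Classical in
/-- The extension by zero of a flow on the induced subgraph of `H` to all of `V`. -/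
noncomputable def extendFlow (H : Finset V) (g : ↥(H : Set V) → ↥(H : Set V) → ℝ) (u w : V) : ℝ :=
  if h : u ∈ H ∧ w ∈ H then g ⟨u, h.1⟩ ⟨w, h.2⟩ else 0

variable (g : ↥(H : Set V) → ↥(H : Set V) → ℝ)

theorem extendFlow_coe (u w : (H : Set V)) : extendFlow H g u w = g u w :=
  dif_pos ⟨u.2, w.2⟩

theorem extendFlow_of_not_mem {u w : V} (h : ¬(u ∈ H ∧ w ∈ H)) : extendFlow H g u w = 0 :=
  dif_neg h

theorem extendFlow_antisymm {g : ↥(H : Set V) → ↥(H : Set V) → ℝ} (hg : ∀ u w, g w u = -g u w)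
    (u w : V) : extendFlow H g w u = -extendFlow H g u w := by
  by_cases h : u ∈ H ∧ w ∈ H
  · lift u to (H : Set V) using h.1
    lift w to (H : Set V) using h.2
    rw [extendFlow_coe, extendFlow_coe, hg]
  · rw [extendFlow_of_not_mem g h, extendFlow_of_not_mem g (mt And.symm h), neg_zero]

theorem sum_univ_eq_sum_coe [Fintype V] {F : V → ℝ} (hF : ∀ u ∉ H, F u = 0) :
    ∑ u, F u = ∑ u : (H : Set V), F u := by
  rw [← Finset.sum_subset (Finset.subset_univ H) fun u _ hu => hF u hu]
  exact (Finset.sum_coe_sort H F).symm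

theorem sum_extendFlow [Fintype V] (u : (H : Set V)) :
    ∑ w, extendFlow H g u w = ∑ w, g u w := by
  rw [sum_univ_eq_sum_coe fun w hw => extendFlow_of_not_mem g fun h => hw h.2]
  simp only [extendFlow_coe]

theorem flowEnergy_extendFlow [Fintype V] : flowEnergy (extendFlow H g) = flowEnergy g := by
  have hzero : ∀ u w, ¬(u ∈ H ∧ w ∈ H) → extendFlow H g u w ^ 2 = 0 := fun u w h => by
    rw [extendFlow_of_not_mem g h, zero_pow two_ne_zero]
  rw [flowEnergy, flowEnergy,
    sum_univ_eq_sum_coe fun u hu => Finset.sum_eq_zero fun w _ => hzero u w fun h => hu h.1]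
  simp_rw [sum_univ_eq_sum_coe fun w hw => hzero _ w fun h => hw h.2, extendFlow_coe]

end Extend

section FixedGraph

theorem privacy_budget_eq {m ε c κ B : ℝ} (hm : m ≠ 0) (hε : ε ≠ 0) (hc : c ≠ 0) (hκ : 0 < κ)
    (hB : B ≠ 0) :
    (1 / m / (c ^ 2 / (m * ε ^ 2)) + B / (κ * (c ^ 2 / (m * ε ^ 2)) * m * B)) *
      (κ / (κ + 1) * c ^ 2) = ε ^ 2 := by
  field_simp

theorem two_mul_log_lt_of_mul_rpow_le {δ δ' s C : ℝ} (hδ' : 0 < δ') (hs : 0 < s)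
    (hC : 2 * Real.log (1.25 / δ') < C) (hδ : 1.25 * (δ' / 1.25) ^ s ≤ δ) :
    2 * Real.log (1.25 / δ) < s * C := by
  have hpos : 0 < (δ' / 1.25) ^ s := by positivity
  have hle : 1.25 / δ ≤ (1.25 / δ') ^ s := by
    rw [← inv_div δ', Real.inv_rpow (by positivity), ← one_div,
      div_le_div_iff₀ (hδ.trans_lt' (by positivity)) hpos]
    linarith
  have hδ0 : 0 < δ := hδ.trans_lt' (by positivity)
  have hlog := Real.log_le_log (by positivity) hle
  rw [Real.log_rpow (by positivity)] at hlog
  linarith [mul_lt_mul_of_pos_left hC hs]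

variable {n : ℕ} {G : SimpleGraph (Fin n)} {H : Finset (Fin n)}

theorem isDP_gopa_of_exists_isSpreadingFlow {B : ℝ} (hB : 0 < B)
    (hflow : ∀ v, ∃ g, IsSpreadingFlow (G.induce (H : Set (Fin n))) v g ∧ flowEnergy g ≤ B)
    {ε δ δ' c κ : ℝ} (hε0 : 0 < ε) (hε1 : ε ≤ 1) (hδ'0 : 0 < δ') (hδ'1 : δ' ≤ 1)
    (hc : 2 * Real.log (1.25 / δ') < c ^ 2) (hκ : 0 < κ) {varEta varDelta : ℝ≥0}
    (hE : (varEta : ℝ) = c ^ 2 / (H.card * ε ^ 2)) (hD : (varDelta : ℝ) = κ * varEta * H.card * B)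
    (hδ : 1.25 * (δ' / 1.25) ^ (κ / (κ + 1)) ≤ δ) (ν : ProbabilityMeasure (Noise n)) :
    IsDP H ε δ (gopa G H varEta varDelta ν) := by
  intro v hv X X' hX hX' hXX' O hO
  have hm : (0 : ℝ) < H.card := Nat.cast_pos.2 (Finset.card_pos.2 ⟨v, hv⟩)
  have hlog : 0 ≤ Real.log (1.25 / δ') :=
    Real.log_nonneg (by rw [le_div_iff₀ hδ'0]; linarith)
  have hc2 : 0 < c ^ 2 := by linarith
  have hE0 : (0 : ℝ) < varEta := by rw [hE]; positivity
  have hD0 : (0 : ℝ) < varDelta := by rw [hD]; positivity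
  obtain ⟨g, hg, hgB⟩ := hflow ⟨v, hv⟩
  refine gopa_le_of_flow hv (extendFlow_antisymm hg.antisymm) (fun u w h => ?_) (fun u hu => ?_)
    (NNReal.coe_ne_zero.1 hE0.ne') (NNReal.coe_ne_zero.1 hD0.ne') hε0 hε1
    (hδ.trans_lt' (by positivity)) (two_mul_log_lt_of_mul_rpow_le hδ'0 (by positivity) hc hδ) ?_
    ν hX hX' hXX' hO
  · by_cases hH : u ∈ H ∧ w ∈ H
    · exact (extendFlow_coe g ⟨u, hH.1⟩ ⟨w, hH.2⟩).trans
        (hg.eq_zero_of_not_adj _ _ fun hadj => h ⟨hH.1, hH.2, hadj⟩)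
    · exact extendFlow_of_not_mem g hH
  · have hsum := (sum_extendFlow g ⟨u, hu⟩).trans (hg.sum_eq ⟨u, hu⟩)
    simpa using hsum
  · calc (1 / H.card / varEta + flowEnergy (extendFlow H g) / varDelta) * (κ / (κ + 1) * c ^ 2)
        ≤ (1 / H.card / varEta + B / varDelta) * (κ / (κ + 1) * c ^ 2) := by
          rw [flowEnergy_extendFlow]; gcongr
      _ = ε ^ 2 := by
          rw [hD, hE]
          exact privacy_budget_eq hm.ne' hε0.ne' (pow_ne_zero_iff two_ne_zero |>.1 hc2.ne') hκ
            hB.ne'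

end FixedGraph

section NegativeCorrelation

variable {α β : Type*} [DecidableEq α]

theorem sum_powersetCard_filter_notMem_sum_swap {M : Type*} [AddCommMonoid M] {U : Finset α} {x : α}
    (hx : x ∈ U) (k : ℕ) (f : Finset α → M) :
    ∑ T ∈ U.powersetCard k with x ∉ T, ∑ j ∈ T, f (insert x (T.erase j)) =
      ∑ T ∈ U.powersetCard k with x ∈ T, ∑ _j ∈ U \ T, f T := by
  rw [Finset.sum_sigma', Finset.sum_sigma']
  refine Finset.sum_bij' (fun p _ => ⟨insert x (p.1.erase p.2), p.2⟩)
    (fun p _ => ⟨insert p.2 (p.1.erase x), p.2⟩) ?_ ?_ ?_ ?_ fun _ _ => rfl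
  all_goals
    rintro ⟨T, j⟩ hp
    simp only [Finset.mem_sigma, Finset.mem_filter, Finset.mem_powersetCard,
      Finset.mem_sdiff] at hp ⊢
  · grind
  · grind
  · rw [Finset.erase_insert (fun h => hp.1.2 (Finset.mem_of_mem_erase h)),
      Finset.insert_erase hp.2]
  · rw [Finset.erase_insert (fun h => hp.2.2 (Finset.mem_of_mem_erase h)),
      Finset.insert_erase hp.1.2]

theorem mul_sum_powersetCard_le {U : Finset α} {x : α} (hx : x ∈ U) {k : ℕ} {f : Finset α → ℝ}
    (hf : ∀ T, ∀ j ∈ T, x ∉ T → f T ≤ f (insert x (T.erase j))) :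
    k * ∑ T ∈ U.powersetCard k, f T ≤ U.card * ∑ T ∈ U.powersetCard k with x ∈ T, f T := by
  have hswap : k * ∑ T ∈ U.powersetCard k with x ∉ T, f T ≤
      (U.card - k) * ∑ T ∈ U.powersetCard k with x ∈ T, f T :=
    calc k * ∑ T ∈ U.powersetCard k with x ∉ T, f T
        = ∑ T ∈ U.powersetCard k with x ∉ T, ∑ _j ∈ T, f T := by
          rw [Finset.mul_sum]
          refine Finset.sum_congr rfl fun T hT => ?_
          rw [Finset.sum_const, (Finset.mem_powersetCard.1 (Finset.mem_filter.1 hT).1).2,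
            nsmul_eq_mul]
      _ ≤ ∑ T ∈ U.powersetCard k with x ∉ T, ∑ j ∈ T, f (insert x (T.erase j)) :=
          Finset.sum_le_sum fun T hT => Finset.sum_le_sum fun j hj =>
            hf T j hj (Finset.mem_filter.1 hT).2
      _ = ∑ T ∈ U.powersetCard k with x ∈ T, ∑ _j ∈ U \ T, f T :=
          sum_powersetCard_filter_notMem_sum_swap hx k f
      _ = _ := by
          rw [Finset.mul_sum]
          refine Finset.sum_congr rfl fun T hT => ?_
          obtain ⟨hTU, hTk⟩ := Finset.mem_powersetCard.1 (Finset.mem_filter.1 hT).1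
          rw [Finset.sum_const, nsmul_eq_mul, Finset.cast_card_sdiff hTU, hTk]
  rw [← Finset.sum_filter_add_sum_filter_not _ (fun T => x ∈ T)]
  linarith

theorem sum_powersetCard_prod_ite_le {z r : ℝ} (hz : 0 ≤ z) (hzr : z ≤ r) {U W : Finset α}
    (hW : W ⊆ U) {k : ℕ} (hk : k ≤ U.card) :
    ∑ T ∈ U.powersetCard k, ∏ i ∈ W, (if i ∈ T then z else r) ≤
      (U.powersetCard k).card * (r - k / U.card * (r - z)) ^ W.card := by
  have hp : (k : ℝ) / U.card ≤ 1 := div_le_one_of_le₀ (by exact_mod_cast hk) (by positivity)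
  have hq : 0 ≤ r - k / U.card * (r - z) := by nlinarith
  induction W using Finset.induction_on with
  | empty => simp
  | insert x W hx ih =>
    have hxU : x ∈ U := hW (Finset.mem_insert_self x W)
    have ih := ih fun i hi => hW (Finset.mem_insert_of_mem hi)
    have hcorr := mul_sum_powersetCard_le hxU (k := k)
      (f := fun T => ∏ i ∈ W, if i ∈ T then z else r) fun T j _ _ =>
      Finset.prod_le_prod (fun i _ => by split_ifs <;> linarith) fun i hi => by
        have hix : i ≠ x := fun h => hx (h ▸ hi)
        simp only [Finset.mem_insert, Finset.mem_erase, hix, false_or]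
        split_ifs <;> first | linarith | tauto
    set F : Finset α → ℝ := fun T => ∏ i ∈ W, if i ∈ T then z else r
    have hU : (0 : ℝ) < U.card := by exact_mod_cast Finset.card_pos.2 ⟨x, hxU⟩
    have hinsert : ∑ T ∈ U.powersetCard k, ∏ i ∈ insert x W, (if i ∈ T then z else r) =
        r * ∑ T ∈ U.powersetCard k, F T -
          (r - z) * ∑ T ∈ U.powersetCard k with x ∈ T, F T := by
      rw [Finset.sum_filter, Finset.mul_sum, Finset.mul_sum, ← Finset.sum_sub_distrib]
      refine Finset.sum_congr rfl fun T _ => ?_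
      rw [Finset.prod_insert hx]
      split_ifs <;> ring
    calc _ = r * ∑ T ∈ U.powersetCard k, F T -
          (r - z) * ∑ T ∈ U.powersetCard k with x ∈ T, F T := hinsert
      _ ≤ r * ∑ T ∈ U.powersetCard k, F T -
          (r - z) * (k / U.card * ∑ T ∈ U.powersetCard k, F T) := by
        rw [div_mul_eq_mul_div]
        have : 0 ≤ r - z := by linarith
        gcongr
        rwa [div_le_iff₀' hU]
      _ = (r - k / U.card * (r - z)) * ∑ T ∈ U.powersetCard k, F T := by ring
      _ ≤ (r - k / U.card * (r - z)) *
          ((U.powersetCard k).card * (r - k / U.card * (r - z)) ^ W.card) := by gcongr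
      _ = _ := by rw [Finset.card_insert_of_notMem hx]; ring

variable [Fintype α] {t : α → Finset β}

theorem sum_piFinset_sum_update (t : α → Finset β) (u : α) (F : (α → β) → ℝ) :
    ∑ S ∈ Fintype.piFinset t, ∑ T ∈ t u, F (Function.update S u T) =
      (t u).card * ∑ S ∈ Fintype.piFinset t, F S := by
  classical
  calc ∑ S ∈ Fintype.piFinset t, ∑ T ∈ t u, F (Function.update S u T)
      = ∑ p ∈ Fintype.piFinset t ×ˢ t u, F (Function.update p.1 u p.2) :=
        (Finset.sum_product' _ _ _).symm
    _ = ∑ p ∈ Fintype.piFinset t ×ˢ t u, F p.1 := by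
        refine Finset.sum_nbij' (fun p => (Function.update p.1 u p.2, p.1 u))
          (fun p => (Function.update p.1 u p.2, p.1 u)) ?_ ?_ (by simp) (by simp) (by simp)
        all_goals
          rintro ⟨S, T⟩ hp
          simp only [Finset.mem_product, Fintype.mem_piFinset] at hp ⊢
          refine ⟨fun a => ?_, hp.1 u⟩
          obtain rfl | ha := eq_or_ne a u
          · simpa using hp.2
          · simpa [ha] using hp.1 a
    _ = _ := by simp only [Finset.sum_product, Finset.sum_const, nsmul_eq_mul, Finset.mul_sum]

theorem sum_piFinset_mul_le {u : α} {f b g : (α → β) → ℝ} (hg : ∀ S, 0 ≤ g S)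
    (hgu : ∀ S T, g (Function.update S u T) = g S)
    (hfb : ∀ S, ∑ T ∈ t u, f (Function.update S u T) ≤ (t u).card * b S) :
    ∑ S ∈ Fintype.piFinset t, f S * g S ≤ ∑ S ∈ Fintype.piFinset t, b S * g S := by
  classical
  rcases (t u).eq_empty_or_nonempty with hu | hu
  · rw [Fintype.piFinset_eq_empty.2 ⟨u, hu⟩, Finset.sum_empty, Finset.sum_empty]
  refine le_of_mul_le_mul_left ?_ (Nat.cast_pos.2 (Finset.card_pos.2 hu) : (0 : ℝ) < _)
  calc ((t u).card : ℝ) * ∑ S ∈ Fintype.piFinset t, f S * g S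
      = ∑ S ∈ Fintype.piFinset t, (∑ T ∈ t u, f (Function.update S u T)) * g S := by
        rw [← sum_piFinset_sum_update]
        simp only [hgu, Finset.sum_mul]
    _ ≤ ∑ S ∈ Fintype.piFinset t, (t u).card * b S * g S :=
        Finset.sum_le_sum fun S _ => mul_le_mul_of_nonneg_right (hfb S) (hg S)
    _ = _ := by simp only [mul_assoc, Finset.mul_sum]

theorem sum_piFinset_prod_le {A : Finset α} {f b : α → (α → β) → ℝ} (hf : ∀ u S, 0 ≤ f u S)
    (hb : ∀ u S, 0 ≤ b u S)
    (hfu : ∀ u ∈ A, ∀ v ∈ A, u ≠ v → ∀ S T, f u (Function.update S v T) = f u S)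
    (hbu : ∀ u ∈ A, ∀ v ∈ A, u ≠ v → ∀ S T, b u (Function.update S v T) = b u S)
    (hfb : ∀ u ∈ A, ∀ S, ∑ T ∈ t u, f u (Function.update S u T) ≤ (t u).card * b u S) :
    ∑ S ∈ Fintype.piFinset t, ∏ u ∈ A, f u S ≤ ∑ S ∈ Fintype.piFinset t, ∏ u ∈ A, b u S := by
  have hreplace : ∀ B ⊆ A, ∑ S ∈ Fintype.piFinset t, ∏ u ∈ A, f u S ≤
      ∑ S ∈ Fintype.piFinset t, ∏ u ∈ A, if u ∈ B then b u S else f u S := by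
    intro B
    induction B using Finset.induction_on with
    | empty => simp
    | insert x B hxB ih =>
      intro hBA
      have hxA : x ∈ A := hBA (Finset.mem_insert_self x B)
      have hstep := sum_piFinset_mul_le (g := fun S => ∏ u ∈ A.erase x,
        if u ∈ B then b u S else f u S) (fun S => Finset.prod_nonneg fun u _ => by
          split_ifs <;> simp only [hf, hb]) (fun S T => Finset.prod_congr rfl fun u hu => by
          obtain ⟨hux, huA⟩ := Finset.mem_erase.1 hu
          rw [hfu u huA x hxA hux, hbu u huA x hxA hux]) (hfb x hxA)
      refine (ih ((Finset.subset_insert x B).trans hBA)).trans (le_of_eq_of_le ?_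
        (hstep.trans_eq ?_)) <;>
      refine Finset.sum_congr rfl fun S _ => ?_
      · rw [← Finset.mul_prod_erase A _ hxA, if_neg hxB]
      · rw [← Finset.mul_prod_erase A _ hxA, if_pos (Finset.mem_insert_self x B)]
        refine congrArg _ (Finset.prod_congr rfl fun u hu => ?_)
        simp only [Finset.mem_insert, Finset.ne_of_mem_erase hu, false_or]
  refine (hreplace A subset_rfl).trans_eq (Finset.sum_congr rfl fun S _ => ?_)
  exact Finset.prod_congr rfl fun u hu => if_pos hu

end NegativeCorrelation

section Selections

variable {n k : ℕ}

theorem selectionGraph_adj (S : Fin n → Finset (Fin n)) (u w : Fin n) :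
    (selectionGraph S).Adj u w ↔ u ≠ w ∧ (w ∈ S u ∨ u ∈ S w) := by
  simp [selectionGraph, SimpleGraph.fromRel_adj]

theorem pow_edgeCount_selectionGraph (S : Fin n → Finset (Fin n)) {A C : Finset (Fin n)}
    (hAC : Disjoint A C) (z : ℝ) :
    z ^ edgeCount (selectionGraph S) A C =
      ∏ u ∈ A, ∏ w ∈ C, if w ∈ S u ∨ u ∈ S w then z else 1 := by
  classical
  rw [← Finset.prod_product', Finset.prod_ite, Finset.prod_const, Finset.prod_const, one_pow,
    mul_one]
  unfold edgeCount SimpleGraph.interedges Rel.interedges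
  congr 2
  refine Finset.filter_congr fun p hp => ?_
  obtain ⟨hpA, hpC⟩ := Finset.mem_product.1 hp
  rw [selectionGraph_adj, and_iff_right (Finset.disjoint_iff_ne.1 hAC p.1 hpA p.2 hpC)]

theorem sum_powersetCard_erase_prod_ite_le (hk : k < n) {z r : ℝ} (hz : 0 ≤ z) (hzr : z ≤ r)
    {u : Fin n} {W : Finset (Fin n)} (hu : u ∉ W) :
    ∑ T ∈ (Finset.univ.erase u).powersetCard k, ∏ w ∈ W, (if w ∈ T then z else r) ≤
      ((Finset.univ.erase u).powersetCard k).card *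
        (r - (k : ℝ) / (n - 1) * (r - z)) ^ W.card := by
  have hcard : (Finset.univ.erase u).card = n - 1 := by
    rw [Finset.card_erase_of_mem (Finset.mem_univ u), Finset.card_univ, Fintype.card_fin]
  have hle := sum_powersetCard_prod_ite_le hz hzr (U := Finset.univ.erase u) (W := W) (k := k)
    (fun w hw => Finset.mem_erase.2 ⟨fun h => hu (h ▸ hw), Finset.mem_univ w⟩) (by omega)
  rwa [hcard, Nat.cast_pred (by omega)] at hle

theorem selectionProb_mem_Icc (hk : k < n) : (k : ℝ) / (n - 1) ∈ Set.Icc 0 1 := by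
  have hn : (0 : ℝ) ≤ (k : ℝ) ∧ (k : ℝ) + 1 ≤ n := ⟨Nat.cast_nonneg k, by exact_mod_cast hk⟩
  exact ⟨div_nonneg hn.1 (by linarith), div_le_one_of_le₀ (by linarith) (by linarith)⟩

theorem sum_selections_prod_or_le (hk : k < n) {z : ℝ} (hz0 : 0 ≤ z) (hz1 : z ≤ 1)
    {A C : Finset (Fin n)} (hAC : Disjoint A C) :
    ∑ S ∈ selections n k, ∏ u ∈ A, ∏ w ∈ C, (if w ∈ S u ∨ u ∈ S w then z else 1) ≤
      ∑ S ∈ selections n k, ∏ u ∈ A, ∏ w ∈ C,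
        if u ∈ S w then z else 1 - (k : ℝ) / (n - 1) * (1 - z) := by
  obtain ⟨hp0, hp1⟩ := selectionProb_mem_Icc hk
  have hr : 0 ≤ 1 - (k : ℝ) / (n - 1) * (1 - z) := by nlinarith
  have hne : ∀ u ∈ A, ∀ w ∈ C, w ≠ u := fun u hu w hw =>
    (Finset.disjoint_iff_ne.1 hAC u hu w hw).symm
  refine sum_piFinset_prod_le (fun u S => ?_) (fun u S => ?_) (fun u _ v hv huv S T => ?_)
    (fun u _ v hv _ S T => ?_) fun u hu S => ?_
  · exact Finset.prod_nonneg fun w _ => by split_ifs <;> simp only [hz0, zero_le_one]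
  · exact Finset.prod_nonneg fun w _ => by split_ifs <;> assumption
  · exact Finset.prod_congr rfl fun w hw => by
      rw [Function.update_of_ne huv, Function.update_of_ne (hne v hv w hw)]
  · exact Finset.prod_congr rfl fun w hw => by rw [Function.update_of_ne (hne v hv w hw)]
  have hsplit : ∀ T, (∏ w ∈ C,
      if w ∈ Function.update S u T u ∨ u ∈ Function.update S u T w then z else 1) =
      z ^ (C.filter fun w => u ∈ S w).card *
        ∏ w ∈ C.filter fun w => u ∉ S w, if w ∈ T then z else 1 := fun T => by
    rw [← Finset.prod_filter_mul_prod_filter_not C (fun w => u ∈ S w), ← Finset.prod_const]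
    refine congrArg₂ _ (Finset.prod_congr rfl fun w hw => ?_)
      (Finset.prod_congr rfl fun w hw => ?_) <;>
    obtain ⟨hwC, hw⟩ := Finset.mem_filter.1 hw <;>
    rw [Function.update_of_ne (hne u hu w hwC), Function.update_self]
    · rw [if_pos (Or.inr hw)]
    · simp only [hw, or_false]
  have hle := sum_powersetCard_erase_prod_ite_le hk hz0 hz1 (u := u)
    (W := C.filter fun w => u ∉ S w) fun h => hne u hu u (Finset.mem_filter.1 h).1 rfl
  rw [Finset.sum_congr rfl fun T _ => hsplit T, ← Finset.mul_sum, Finset.prod_ite,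
    Finset.prod_const, Finset.prod_const, mul_left_comm]
  exact mul_le_mul_of_nonneg_left hle (pow_nonneg hz0 _)

theorem sum_selections_prod_mem_le (hk : k < n) {z r : ℝ} (hz : 0 ≤ z) (hzr : z ≤ r)
    {A C : Finset (Fin n)} (hAC : Disjoint A C) :
    ∑ S ∈ selections n k, ∏ w ∈ C, ∏ u ∈ A, (if u ∈ S w then z else r) ≤
      (selections n k).card * ((r - (k : ℝ) / (n - 1) * (r - z)) ^ A.card) ^ C.card := by
  have hp1 := (selectionProb_mem_Icc hk).2
  have hq : 0 ≤ r - (k : ℝ) / (n - 1) * (r - z) := by nlinarith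
  calc ∑ S ∈ selections n k, ∏ w ∈ C, ∏ u ∈ A, (if u ∈ S w then z else r)
      ≤ ∑ S ∈ selections n k, ∏ _w ∈ C, (r - (k : ℝ) / (n - 1) * (r - z)) ^ A.card := by
        refine sum_piFinset_prod_le (fun w S => ?_) (fun _ _ => pow_nonneg hq _)
          (fun w _ v _ hwv S T => ?_) (fun _ _ _ _ _ _ _ => rfl) fun w hw S => ?_
        · exact Finset.prod_nonneg fun u _ => by split_ifs <;> linarith
        · simp only [Function.update_of_ne hwv]
        · simp only [Function.update_self]
          exact sum_powersetCard_erase_prod_ite_le hk hz hzr fun hwA =>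
            Finset.disjoint_left.1 hAC hwA hw
    _ = _ := by rw [Finset.sum_const, nsmul_eq_mul, Finset.prod_const]

theorem sum_pow_edgeCount_le (hk : k < n) {z : ℝ} (hz0 : 0 ≤ z) (hz1 : z ≤ 1)
    {A C : Finset (Fin n)} (hAC : Disjoint A C) :
    ∑ S ∈ selections n k, z ^ edgeCount (selectionGraph S) A C ≤
      (selections n k).card *
        (1 - (1 - z) * (2 * ((k : ℝ) / (n - 1)) - ((k : ℝ) / (n - 1)) ^ 2)) ^
          (A.card * C.card) := by
  have hp1 := (selectionProb_mem_Icc hk).2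
  simp only [pow_edgeCount_selectionGraph _ hAC]
  refine (sum_selections_prod_or_le hk hz0 hz1 hAC).trans ?_
  simp only [Finset.prod_comm (s := A)]
  refine (sum_selections_prod_mem_le hk hz0 (by nlinarith) hAC).trans_eq ?_
  rw [← pow_mul]
  ring

theorem card_filter_edgeCount_lt_le (hk : k < n) {z : ℝ} (hz0 : 0 < z) (hz1 : z ≤ 1)
    {A C : Finset (Fin n)} (hAC : Disjoint A C) (θ : ℝ) :
    (((selections n k).filter fun S => (edgeCount (selectionGraph S) A C : ℝ) < θ).card : ℝ) ≤
      (selections n k).card * Real.exp (-Real.log z * θ - (1 - z) *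
        (2 * ((k : ℝ) / (n - 1)) - ((k : ℝ) / (n - 1)) ^ 2) * (A.card * C.card)) := by
  set x := 2 * ((k : ℝ) / (n - 1)) - ((k : ℝ) / (n - 1)) ^ 2
  have hx1 : (1 - z) * x ≤ 1 := by nlinarith [sq_nonneg ((k : ℝ) / (n - 1) - 1)]
  have hpow : (1 - (1 - z) * x) ^ (A.card * C.card) ≤
      Real.exp (-((1 - z) * x * (A.card * C.card))) :=
    calc _ ≤ Real.exp (-((1 - z) * x)) ^ (A.card * C.card) :=
          pow_le_pow_left₀ (by linarith) (Real.one_sub_le_exp_neg _) _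
      _ = _ := by rw [← Real.exp_nat_mul, Nat.cast_mul]; ring_nf
  have hmarkov : (((selections n k).filter fun S =>
      (edgeCount (selectionGraph S) A C : ℝ) < θ).card : ℝ) * Real.exp (Real.log z * θ) ≤
      ∑ S ∈ selections n k, z ^ edgeCount (selectionGraph S) A C := by
    rw [← nsmul_eq_mul, ← Finset.sum_const]
    refine (Finset.sum_le_sum fun S hS => ?_).trans (Finset.sum_le_sum_of_subset_of_nonneg
      (Finset.filter_subset _ _) fun S _ _ => by positivity)
    rw [← Real.rpow_natCast, Real.rpow_def_of_pos hz0]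
    exact Real.exp_le_exp.2 (mul_le_mul_of_nonpos_left (Finset.mem_filter.1 hS).2.le
      (Real.log_nonpos hz0.le hz1))
  rw [sub_eq_neg_add, Real.exp_add, neg_mul, Real.exp_neg (Real.log z * θ), ← mul_assoc,
    ← div_eq_mul_inv, le_div_iff₀ (Real.exp_pos _)]
  exact hmarkov.trans ((sum_pow_edgeCount_le hk hz0.le hz1 hAC).trans
    (mul_le_mul_of_nonneg_left hpow (Nat.cast_nonneg _)))

end Selections

section UnionBound

theorem lt_log_two_mul {m : ℝ} (hm : 81 ≤ m) : 5.05 < Real.log (2 * m) := by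
  have hlog : Real.log (2 * 3 ^ 4) ≤ Real.log (2 * m) :=
    Real.log_le_log (by norm_num) (by linarith)
  rw [Real.log_mul (by norm_num) (by norm_num), Real.log_pow] at hlog
  have hlog3 := Real.log_three_gt_d9
  have hlog2 := Real.log_two_gt_d9
  push_cast at hlog
  linarith

theorem choose_le_exp {m b : ℕ} (hb : 0 < b) (hm : 0 < m) :
    (m.choose b : ℝ) ≤ Real.exp (b * (1 - Real.log (b / m))) := by
  have hexp : Real.exp (b * (1 - Real.log (b / m))) = Real.exp b * ((m : ℝ) / b) ^ b := by
    rw [mul_sub, mul_one, sub_eq_add_neg, Real.exp_add, ← mul_neg, ← Real.log_inv, inv_div,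
      Real.exp_nat_mul, Real.exp_log (by positivity)]
  calc (m.choose b : ℝ) ≤ (m : ℝ) ^ b / b.factorial := Nat.choose_le_pow_div b m
    _ = (b : ℝ) ^ b / b.factorial * ((m : ℝ) / b) ^ b := by rw [div_pow]; field_simp
    _ ≤ Real.exp b * ((m : ℝ) / b) ^ b := by
        gcongr
        exact Real.pow_div_factorial_le_exp _ b.cast_nonneg b
    _ = _ := hexp.symm

-- The left side is convex in `y`, so it suffices to check the end points.
theorem entropy_sub_le {m y : ℝ} (hm : 81 ≤ m) (hy : 3 / m ≤ y) (hy2 : y ≤ 1 / 2) :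
    1 + Real.log 2 - Real.log y - 1.08 * (1 - y) * Real.log (2 * m) ≤ -0.25 := by
  have hl := lt_log_two_mul hm
  have hm0 : 0 < m := by linarith
  set l := Real.log (2 * m) with hldef
  have hconv : ConvexOn ℝ (Set.Ioi 0) fun y : ℝ =>
      -Real.log y + ((1.08 * l) * y + (1 + Real.log 2 - 1.08 * l)) := by
    refine ConvexOn.add strictConcaveOn_log_Ioi.concaveOn.neg (ConvexOn.add ?_ (convexOn_const _
      (convex_Ioi 0)))
    exact (convexOn_id (convex_Ioi 0)).smul (c := 1.08 * l) (by linarith)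
  have hleft : -Real.log (3 / m) + ((1.08 * l) * (3 / m) + (1 + Real.log 2 - 1.08 * l)) ≤
      -0.25 := by
    have hlog : Real.log (3 / m) = Real.log 3 + Real.log 2 - l := by
      rw [hldef, Real.log_div (by norm_num) hm0.ne', Real.log_mul (by norm_num) hm0.ne']
      ring
    have hdiv : 3 / m ≤ 1 / 27 := by
      rw [div_le_div_iff₀ hm0 (by norm_num)]; linarith
    have hlog3 := Real.log_three_gt_d9
    rw [hlog]
    nlinarith
  have hright : -Real.log (1 / 2) + ((1.08 * l) * (1 / 2) + (1 + Real.log 2 - 1.08 * l)) ≤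
      -0.25 := by
    have hlog2 := Real.log_two_lt_d9
    rw [one_div, Real.log_inv]
    linarith
  have hmax := hconv.le_max_of_mem_Icc (show (0 : ℝ) < 3 / m by positivity)
    (show (0 : ℝ) < 1 / 2 by norm_num) ⟨hy, hy2⟩
  linarith [hmax.trans (max_le hleft hright)]

theorem union_bound_term_one_le {m : ℕ} (hm : 81 ≤ m) :
    m * Real.exp (-(2.16 * (m - 1 : ℕ) / m * Real.log (2 * m))) ≤ 0.07 * 0.8 := by
  have hmR : (81 : ℝ) ≤ m := by exact_mod_cast hm
  have hm0 : (0 : ℝ) < m := by linarith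
  have hl := lt_log_two_mul hmR
  have hfactor : 2 ≤ 2.16 * ((m - 1 : ℕ) : ℝ) / m := by
    rw [le_div_iff₀ hm0, Nat.cast_pred (by omega)]
    linarith
  calc m * Real.exp (-(2.16 * (m - 1 : ℕ) / m * Real.log (2 * m)))
      ≤ m * Real.exp (-(2 * Real.log (2 * m))) := by
        gcongr
    _ = m * (1 / (2 * m) ^ 2) := by
        rw [Real.exp_neg, two_mul, Real.exp_add, Real.exp_log (by positivity), one_div, sq]
    _ = 1 / (4 * m) := by field_simp; ring
    _ ≤ 1 / (4 * 81) := by gcongr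
    _ ≤ _ := by norm_num

theorem exp_neg_two_point_seven_le : Real.exp (-2.7) ≤ 0.07 := by
  rw [Real.exp_neg, inv_le_comm₀ (Real.exp_pos _) (by norm_num)]
  refine le_trans ?_ (Real.sum_le_exp_of_nonneg (x := 2.7) (by norm_num) 8)
  norm_num [Finset.sum_range_succ, Nat.factorial]

theorem exp_neg_quarter_le : Real.exp (-0.25) ≤ 0.8 := by
  rw [Real.exp_neg, inv_le_comm₀ (Real.exp_pos _) (by norm_num)]
  have hexp := Real.add_one_le_exp (0.25 : ℝ)
  norm_num at hexp ⊢
  exact hexp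

theorem union_bound_term_le_of_three_le {m a b : ℕ} (hm : 81 ≤ m) (hb : 3 ≤ b) (hab : a ≤ b)
    (hba : b + 1 ≤ 2 * a) (hbm : 2 * b ≤ m) :
    (m.choose b : ℝ) * b.choose a *
      Real.exp (-(2.16 * a * (m - b : ℕ) / m * Real.log (2 * m))) ≤ 0.07 * 0.8 ^ a := by
  rify at hm hb hab hba hbm
  have hm0 : (0 : ℝ) < m := by linarith
  have hl := lt_log_two_mul hm
  set l := Real.log (2 * m)
  set y : ℝ := b / m with hy
  have hy2 : y ≤ 1 / 2 := by
    rw [hy, div_le_div_iff₀ hm0 (by norm_num)]; linarith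
  have hchoose : (m.choose b : ℝ) ≤ Real.exp (b * (1 - Real.log y)) :=
    choose_le_exp (by rify; linarith) (by rify; linarith)
  have hchoose2 : (b.choose a : ℝ) ≤ Real.exp (b * Real.log 2) := by
    rw [Real.exp_nat_mul, Real.exp_log (by norm_num)]
    exact_mod_cast Nat.choose_le_two_pow b a
  have hcut : (1 - y) * l * (1.08 * (b + 1)) ≤ 2.16 * a * (m - b : ℕ) / m * l :=
    calc (1 - y) * l * (1.08 * (b + 1)) ≤ (1 - y) * l * (2.16 * a) :=
          mul_le_mul_of_nonneg_left (by linarith) (mul_nonneg (by linarith) (by linarith))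
      _ = 2.16 * a * (m - b : ℕ) / m * l := by
          rw [Nat.cast_sub (by rify; linarith), hy]; field_simp
  have hentropy := mul_le_mul_of_nonneg_left (entropy_sub_le hm (by rw [hy]; gcongr) hy2)
    (by linarith : (0 : ℝ) ≤ b)
  have hbase : 0.5 * 5.05 ≤ (1 - y) * l := by nlinarith
  calc _ ≤ Real.exp (b * (1 - Real.log y)) * Real.exp (b * Real.log 2) *
        Real.exp (-(2.16 * a * (m - b : ℕ) / m * l)) := by gcongr
    _ = Real.exp (b * (1 - Real.log y) + b * Real.log 2 - 2.16 * a * (m - b : ℕ) / m * l) := by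
        rw [← Real.exp_add, ← Real.exp_add, ← sub_eq_add_neg]
    _ ≤ Real.exp (-2.7 + a * (-0.25)) := Real.exp_le_exp.2 (by nlinarith)
    _ = Real.exp (-2.7) * Real.exp (-0.25) ^ a := by rw [Real.exp_add, Real.exp_nat_mul]
    _ ≤ 0.07 * 0.8 ^ a := by
        gcongr
        · exact exp_neg_two_point_seven_le
        · exact exp_neg_quarter_le

theorem union_bound_term_le {m a : ℕ} (hm : 81 ≤ m) (ha : 1 ≤ a) (ham : a ≤ m / 2) :
    (m.choose (min (2 * a - 1) (m / 2)) : ℝ) * (min (2 * a - 1) (m / 2)).choose a *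
      Real.exp (-(2.16 * a * (m - min (2 * a - 1) (m / 2) : ℕ) / m * Real.log (2 * m))) ≤
      0.07 * 0.8 ^ a := by
  rcases Nat.eq_or_lt_of_le ha with rfl | ha2
  · rw [show min (2 * 1 - 1) (m / 2) = 1 by omega]
    simpa using union_bound_term_one_le hm
  · exact union_bound_term_le_of_three_le hm (by omega) (by omega) (by omega) (by omega)

theorem union_bound_term_le_mul {m a : ℕ} (hm : 81 ≤ m) (ha : 1 ≤ a) (ham : a ≤ m / 2) {d δ : ℝ}
    (hδ0 : 0 < δ) (hδ1 : δ ≤ 1) (hd : 4 * Real.log (2 * m / δ) ≤ d) :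
    (m.choose (min (2 * a - 1) (m / 2)) : ℝ) * (min (2 * a - 1) (m / 2)).choose a *
      Real.exp (-(0.54 * d * a * (m - min (2 * a - 1) (m / 2) : ℕ) / m)) ≤
      0.07 * 0.8 ^ a * δ := by
  have hterm := union_bound_term_le hm ha ham
  set b := min (2 * a - 1) (m / 2)
  set E : ℝ := 2.16 * a * (m - b : ℕ) / m with hE
  have hm0 : (0 : ℝ) < m := by exact_mod_cast (by omega : 0 < m)
  have hE1 : 1 ≤ E := by
    have hmb : (m : ℝ) ≤ 2 * (m - b : ℕ) := by exact_mod_cast (by omega : m ≤ 2 * (m - b))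
    have ha1 : (1 : ℝ) ≤ a := by exact_mod_cast ha
    rw [hE, le_div_iff₀ hm0]
    nlinarith
  have hlogδ : Real.log δ ≤ 0 := Real.log_nonpos hδ0.le hδ1
  rw [Real.log_div (by positivity) hδ0.ne'] at hd
  calc _ ≤ (m.choose b : ℝ) * b.choose a * Real.exp (-(E * Real.log (2 * m)) + Real.log δ) := by
        gcongr
        rw [show 0.54 * d * a * (m - b : ℕ) / m = E * (d / 4) by rw [hE]; ring]
        nlinarith
    _ = (m.choose b : ℝ) * b.choose a * Real.exp (-(E * Real.log (2 * m))) * δ := by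
        rw [Real.exp_add, Real.exp_log hδ0, ← mul_assoc]
    _ ≤ _ := by gcongr

theorem union_bound_le {m : ℕ} (hm : 81 ≤ m) {d δ : ℝ} (hδ0 : 0 < δ) (hδ1 : δ ≤ 1)
    (hd : 4 * Real.log (2 * m / δ) ≤ d) :
    ∑ a ∈ Finset.Icc 1 (m / 2), (m.choose (min (2 * a - 1) (m / 2)) : ℝ) *
      (min (2 * a - 1) (m / 2)).choose a *
      Real.exp (-(0.54 * d * a * (m - min (2 * a - 1) (m / 2) : ℕ) / m)) ≤ 2 / 3 * δ := by
  have hgeom : ∑ a ∈ Finset.Icc 1 (m / 2), (0.8 : ℝ) ^ a ≤ 5 :=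
    calc ∑ a ∈ Finset.Icc 1 (m / 2), (0.8 : ℝ) ^ a ≤ ∑' a : ℕ, (0.8 : ℝ) ^ a :=
          (summable_geometric_of_lt_one (by norm_num) (by norm_num)).sum_le_tsum _
            fun a _ => by positivity
      _ = 5 := by rw [tsum_geometric_of_lt_one (by norm_num) (by norm_num)]; norm_num
  calc _ ≤ ∑ a ∈ Finset.Icc 1 (m / 2), 0.07 * 0.8 ^ a * δ :=
        Finset.sum_le_sum fun a ha => union_bound_term_le_mul hm (Finset.mem_Icc.1 ha).1
          (Finset.mem_Icc.1 ha).2 hδ0 hδ1 hd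
    _ = 0.07 * (∑ a ∈ Finset.Icc 1 (m / 2), (0.8 : ℝ) ^ a) * δ := by
        rw [← Finset.sum_mul, ← Finset.mul_sum]
    _ ≤ 2 / 3 * δ := by
        gcongr
        linarith

end UnionBound

section SparseCut

variable {n k : ℕ}

theorem edgeCount_induce (G : SimpleGraph (Fin n)) (H : Finset (Fin n))
    (A C : Finset (H : Set (Fin n))) :
    edgeCount (G.induce (H : Set (Fin n))) A C =
      edgeCount G (A.map (Function.Embedding.subtype _))
        (C.map (Function.Embedding.subtype _)) := by
  classical
  unfold edgeCount SimpleGraph.interedges Rel.interedges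
  rw [← Finset.prodMap_map_product, Finset.filter_map, Finset.card_map]
  rfl

theorem edgeCount_selectionGraph_congr {S M : Fin n → Finset (Fin n)} {A C : Finset (Fin n)}
    (hA : ∀ u ∈ A, M u = S u) (hC : ∀ u ∈ C, M u = S u) :
    edgeCount (selectionGraph M) A C = edgeCount (selectionGraph S) A C := by
  classical
  unfold edgeCount SimpleGraph.interedges Rel.interedges
  refine congrArg Finset.card (Finset.filter_congr fun p hp => ?_)
  obtain ⟨hpA, hpC⟩ := Finset.mem_product.1 hp
  rw [selectionGraph_adj, selectionGraph_adj, hA _ hpA, hC _ hpC]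

/-- The selections `S` under which the honest users violate the condition in `IsExpanding` for the
expansion `τ`. It only depends on the selections of the honest users. -/
def SparseCut (H : Finset (Fin n)) (τ : ℝ) (S : Fin n → Finset (Fin n)) : Prop :=
  ∃ a ∈ Finset.Icc 1 (H.card / 2),
    ∃ C ∈ H.powersetCard (H.card - min (2 * a - 1) (H.card / 2)),
      ∃ A ∈ (H \ C).powersetCard a,
        (edgeCount (selectionGraph S) A C : ℝ) < τ * a * C.card / H.card

theorem isExpanding_of_not_sparseCut {H : Finset (Fin n)} {τ : ℝ} {S M : Fin n → Finset (Fin n)}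
    (hM : ∀ u ∈ H, M u = S u) (h : ¬ SparseCut H τ S) :
    IsExpanding ((selectionGraph M).induce (H : Set (Fin n))) τ := by
  classical
  intro A C hAC hA1 hA2 hC
  rw [show Fintype.card (H : Set (Fin n)) = H.card from Fintype.card_coe H] at hA2 hC ⊢
  set ι := Function.Embedding.subtype fun u => u ∈ (H : Set (Fin n))
  have hsub : ∀ A : Finset (H : Set (Fin n)), A.map ι ⊆ H := fun A u hu => by
    obtain ⟨u, -, rfl⟩ := Finset.mem_map.1 hu
    exact u.2
  rw [edgeCount_induce, edgeCount_selectionGraph_congr (fun u hu => hM u (hsub A hu))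
    fun u hu => hM u (hsub C hu)]
  by_contra! hcut
  refine h ⟨A.card, Finset.mem_Icc.2 ⟨hA1, hA2⟩, C.map ι, Finset.mem_powersetCard.2
    ⟨hsub C, by rw [Finset.card_map, hC]⟩, A.map ι, Finset.mem_powersetCard.2
    ⟨Finset.subset_sdiff.2 ⟨hsub A, (Finset.disjoint_map ι).2 hAC⟩, Finset.card_map _⟩, ?_⟩
  rwa [Finset.card_map]

open Classical in
theorem card_filter_sparseCut_le_sum {H : Finset (Fin n)} {τ : ℝ} {F : ℕ → ℕ → ℝ}
    (hF : ∀ A C : Finset (Fin n), Disjoint A C → (((selections n k).filter fun S =>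
      (edgeCount (selectionGraph S) A C : ℝ) < τ * A.card * C.card / H.card).card : ℝ) ≤
        F A.card C.card) :
    (((selections n k).filter (SparseCut H τ)).card : ℝ) ≤
      ∑ a ∈ Finset.Icc 1 (H.card / 2), (H.card.choose (min (2 * a - 1) (H.card / 2)) : ℝ) *
        (min (2 * a - 1) (H.card / 2)).choose a *
          F a (H.card - min (2 * a - 1) (H.card / 2)) := by
  set b : ℕ → ℕ := fun a => min (2 * a - 1) (H.card / 2)
  have hcover : (selections n k).filter (SparseCut H τ) ⊆
      (Finset.Icc 1 (H.card / 2)).biUnion fun a => (H.powersetCard (H.card - b a)).biUnion fun C =>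
        ((H \ C).powersetCard a).biUnion fun A => (selections n k).filter fun S =>
          (edgeCount (selectionGraph S) A C : ℝ) < τ * a * C.card / H.card := fun S hS => by
    obtain ⟨hS, a, ha, C, hC, A, hA, hlt⟩ := Finset.mem_filter.1 hS
    simp only [Finset.mem_biUnion]
    exact ⟨a, ha, C, hC, A, hA, Finset.mem_filter.2 ⟨hS, hlt⟩⟩
  have hunion := Nat.cast_le (α := ℝ).2 ((Finset.card_le_card hcover).trans
    (Finset.card_biUnion_le.trans (Finset.sum_le_sum fun a _ => Finset.card_biUnion_le.trans
      (Finset.sum_le_sum fun C _ => Finset.card_biUnion_le))))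
  push_cast at hunion
  refine hunion.trans (Finset.sum_le_sum fun a _ => ?_)
  have hb : b a ≤ H.card := (min_le_right _ _).trans (Nat.div_le_self _ _)
  calc _ ≤ ∑ _C ∈ H.powersetCard (H.card - b a), (b a).choose a * F a (H.card - b a) := by
        refine Finset.sum_le_sum fun C hC => ?_
        obtain ⟨hCH, hCcard⟩ := Finset.mem_powersetCard.1 hC
        calc _ ≤ ∑ _A ∈ (H \ C).powersetCard a, F a (H.card - b a) := by
              refine Finset.sum_le_sum fun A hA => ?_
              obtain ⟨hAH, rfl⟩ := Finset.mem_powersetCard.1 hA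
              rw [← hCcard]
              exact hF A C (Finset.subset_sdiff.1 hAH).2
          _ = _ := by
              rw [Finset.sum_const, Finset.card_powersetCard, Finset.card_sdiff_of_subset hCH,
                hCcard, nsmul_eq_mul, Nat.sub_sub_self hb]
    _ = _ := by
        rw [Finset.sum_const, Finset.card_powersetCard, Nat.choose_symm hb, nsmul_eq_mul, mul_assoc]

theorem card_filter_edgeCount_lt_two_thirds_le (hk : k < n) {A C : Finset (Fin n)}
    (hAC : Disjoint A C) :
    (((selections n k).filter fun S => (edgeCount (selectionGraph S) A C : ℝ) <
      2 / 3 * ((k : ℝ) / n) * (1 - 5 / 6 * ((k : ℝ) / n)) * (A.card * C.card)).card : ℝ) ≤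
      (selections n k).card * Real.exp (-(0.54 * ((k : ℝ) / n) * (A.card * C.card))) := by
  refine (card_filter_edgeCount_lt_le hk (z := 1 / 3) (by norm_num) (by norm_num) hAC _).trans
    (mul_le_mul_of_nonneg_left (Real.exp_le_exp.2 ?_) (Nat.cast_nonneg _))
  obtain ⟨-, hp1⟩ := selectionProb_mem_Icc hk
  have hn1 : (k : ℝ) + 1 ≤ n := by exact_mod_cast hk
  have hk0 : (0 : ℝ) ≤ k := Nat.cast_nonneg k
  have hβ0 : 0 ≤ (k : ℝ) / n := by positivity
  have hβp : (k : ℝ) / n ≤ k / (n - 1) := by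
    rcases hk0.eq_or_lt with hk0 | hk0
    · simp [← hk0]
    · exact div_le_div_of_nonneg_left hk0.le (by linarith) (by linarith)
  set β : ℝ := (k : ℝ) / n
  set p : ℝ := (k : ℝ) / (n - 1)
  have hedge : 2 * β - β ^ 2 ≤ 2 * p - p ^ 2 := by nlinarith
  have hlog : Real.log 3 * (2 / 3 * β * (1 - 5 / 6 * β)) ≤
      1.0987 * (2 / 3 * β * (1 - 5 / 6 * β)) :=
    mul_le_mul_of_nonneg_right (Real.log_three_lt_d9.le.trans (by norm_num))
      (mul_nonneg (by positivity) (by linarith))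
  have hrate : Real.log 3 * (2 / 3 * β * (1 - 5 / 6 * β)) - (1 - 1 / 3) * (2 * p - p ^ 2) ≤
      -(0.54 * β) := by nlinarith
  rw [one_div, Real.log_inv, neg_neg]
  linarith [mul_le_mul_of_nonneg_right hrate (by positivity : (0 : ℝ) ≤ A.card * C.card)]

/-- The expansion, in the sense of `IsExpanding`, that a random `k`-out graph on `n` users has with
high probability on a set of `m` users. Two users are adjacent with probability about `2 p - p ^ 2`,
where `p = k / n`; the factor `1 - 5 p / 6` is chosen such that its inverse is at most `1 + 5 p`. -/
noncomputable def kOutExpansion (n k m : ℕ) : ℝ :=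
  2 / 3 * (m * ((k : ℝ) / n)) * (1 - 5 / 6 * ((k : ℝ) / n))

open Classical in
theorem card_filter_sparseCut_le (hk : k < n) {H : Finset (Fin n)} (hm : 81 ≤ H.card) {δ : ℝ}
    (hδ0 : 0 < δ) (hδ1 : δ ≤ 1)
    (hd : 4 * Real.log (2 * H.card / δ) ≤ H.card * ((k : ℝ) / n)) :
    (((selections n k).filter (SparseCut H (kOutExpansion n k H.card))).card : ℝ) ≤
      (selections n k).card * (2 / 3 * δ) := by
  have hm0 : (H.card : ℝ) ≠ 0 := by exact_mod_cast (by omega : H.card ≠ 0)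
  refine (card_filter_sparseCut_le_sum (F := fun a c => (selections n k).card *
    Real.exp (-(0.54 * (H.card * ((k : ℝ) / n)) * a * c / H.card))) fun A C hAC => ?_).trans ?_
  · convert card_filter_edgeCount_lt_two_thirds_le hk hAC using 6
    · rw [kOutExpansion]; field_simp
    · field_simp
  · simp only [mul_left_comm _ ((selections n k).card : ℝ), ← Finset.mul_sum]
    exact mul_le_mul_of_nonneg_left (union_bound_le hm hδ0 hδ1 hd) (Nat.cast_nonneg _)

theorem toOuterMeasure_bind_le {α β : Type*} (p : PMF α) (f : α → PMF β) {s : Set α} {t : Set β}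
    (h : ∀ a ∉ s, ∀ b ∈ (f a).support, b ∉ t) :
    (p.bind f).toOuterMeasure t ≤ p.toOuterMeasure s := by
  rw [PMF.toOuterMeasure_bind_apply, PMF.toOuterMeasure_apply]
  refine ENNReal.tsum_le_tsum fun a => ?_
  by_cases ha : a ∈ s
  · rw [Set.indicator_of_mem ha]
    refine mul_le_of_le_one_right' ?_
    rw [PMF.toOuterMeasure_apply, ← (f a).tsum_coe]
    exact ENNReal.tsum_le_tsum fun b => Set.indicator_le_self _ _ _
  · rw [((f a).toOuterMeasure_apply_eq_zero_iff t).2 (Set.disjoint_left.2 (h a ha)), mul_zero]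
    exact bot_le

theorem kOutGraph_not_isExpanding_le (hk : k < n) {H : Finset (Fin n)} (hm : 81 ≤ H.card)
    {δ : ℝ} (hδ0 : 0 < δ) (hδ1 : δ ≤ 1)
    (hd : 4 * Real.log (2 * H.card / δ) ≤ H.card * ((k : ℝ) / n))
    (Q : PMF (Fin n → Finset (Fin n))) :
    (kOutGraph H k hk Q).toOuterMeasure {G | ¬ IsExpanding (G.induce (H : Set (Fin n)))
      (kOutExpansion n k H.card)} ≤ ENNReal.ofReal (2 / 3 * δ) := by
  classical
  refine (toOuterMeasure_bind_le _ _ (s := {S | SparseCut H (kOutExpansion n k H.card) S})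
    fun S hS G hG => ?_).trans ?_
  · obtain ⟨M, -, rfl⟩ := (PMF.mem_support_map_iff _ _ _).1 hG
    exact not_not.2 <| isExpanding_of_not_sparseCut (fun u hu => if_pos hu) hS
  · rw [PMF.toOuterMeasure_uniformOfFinset_apply]
    refine ENNReal.div_le_of_le_mul ?_
    rw [← ENNReal.ofReal_natCast, ← ENNReal.ofReal_natCast, ← ENNReal.ofReal_mul (by positivity),
      mul_comm]
    exact ENNReal.ofReal_le_ofReal (card_filter_sparseCut_le hk hm hδ0 hδ1 hd)

end SparseCut

section RandomGraph

variable {n : ℕ} {H : Finset (Fin n)}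

instance isProbabilityMeasure_gopa (G : SimpleGraph (Fin n)) (varEta varDelta : ℝ≥0)
    (ν : Measure (Noise n)) [IsProbabilityMeasure ν] (X : Fin n → ℝ) :
    IsProbabilityMeasure (gopa G H varEta varDelta ν X) :=
  Measure.isProbabilityMeasure_map (measurable_view G H X).aemeasurable

theorem gopaOnRandomGraph_apply (P : PMF (SimpleGraph (Fin n))) (varEta varDelta : ℝ≥0)
    (ν : SimpleGraph (Fin n) → ProbabilityMeasure (Noise n)) (X : Fin n → ℝ) {O : Set (View n H)}
    (hO : MeasurableSet O) :
    gopaOnRandomGraph P H varEta varDelta ν X O =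
      ∑' G, P G * gopa G H varEta varDelta (ν G) X O := by
  rw [gopaOnRandomGraph, Measure.sum_apply _ hO]
  simp only [Measure.smul_apply, smul_eq_mul]

instance isProbabilityMeasure_gopaOnRandomGraph (P : PMF (SimpleGraph (Fin n)))
    (varEta varDelta : ℝ≥0) (ν : SimpleGraph (Fin n) → ProbabilityMeasure (Noise n))
    (X : Fin n → ℝ) : IsProbabilityMeasure (gopaOnRandomGraph P H varEta varDelta ν X) :=
  ⟨by simp only [gopaOnRandomGraph_apply _ _ _ _ _ MeasurableSet.univ, measure_univ, mul_one,
    PMF.tsum_coe]⟩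

theorem isDP_of_one_le {Ω : Type*} [MeasurableSpace Ω] {A : (Fin n → ℝ) → Measure Ω}
    [∀ X, IsProbabilityMeasure (A X)] {ε δ : ℝ} (hδ : 1 ≤ δ) : IsDP H ε δ A :=
  fun _ _ _ _ _ _ _ _ _ => prob_le_one.trans ((ENNReal.one_le_ofReal.2 hδ).trans le_add_self)

theorem isDP_gopaOnRandomGraph {P : PMF (SimpleGraph (Fin n))} {bad : Set (SimpleGraph (Fin n))}
    {varEta varDelta : ℝ≥0} {ν : SimpleGraph (Fin n) → ProbabilityMeasure (Noise n)}
    {ε δ₁ δ₂ : ℝ} (hδ₁ : 0 ≤ δ₁) (hδ₂ : 0 ≤ δ₂)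
    (hbad : P.toOuterMeasure bad ≤ ENNReal.ofReal δ₂)
    (hgood : ∀ G ∉ bad, IsDP H ε δ₁ (gopa G H varEta varDelta (ν G))) :
    IsDP H ε (δ₁ + δ₂) (gopaOnRandomGraph P H varEta varDelta ν) := by
  intro v hv X X' hX hX' hXX' O hO
  rw [gopaOnRandomGraph_apply _ _ _ _ _ hO, gopaOnRandomGraph_apply _ _ _ _ _ hO,
    ENNReal.ofReal_add hδ₁ hδ₂]
  set e := ENNReal.ofReal (Real.exp ε)
  set d := ENNReal.ofReal δ₁
  have hterm : ∀ G, P G * gopa G H varEta varDelta (ν G) X O ≤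
      e * (P G * gopa G H varEta varDelta (ν G) X' O) + (P G * d + bad.indicator P G) := by
    intro G
    by_cases hG : G ∈ bad
    · rw [Set.indicator_of_mem hG]
      exact (mul_le_of_le_one_right' prob_le_one).trans (le_add_self.trans le_add_self)
    · rw [Set.indicator_of_notMem hG, add_zero, mul_left_comm, ← mul_add]
      gcongr
      exact hgood G hG v hv X X' hX hX' hXX' O hO
  calc ∑' G, P G * gopa G H varEta varDelta (ν G) X O
      ≤ ∑' G, (e * (P G * gopa G H varEta varDelta (ν G) X' O) +
          (P G * d + bad.indicator P G)) := ENNReal.tsum_le_tsum hterm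
    _ = e * ∑' G, P G * gopa G H varEta varDelta (ν G) X' O + (d + P.toOuterMeasure bad) := by
        rw [ENNReal.tsum_add, ENNReal.tsum_add, ENNReal.tsum_mul_left, ENNReal.tsum_mul_right,
          PMF.tsum_coe, one_mul, PMF.toOuterMeasure_apply]
    _ ≤ _ := by gcongr

end RandomGraph

section KOutEnergy

variable {n k m : ℕ}

theorem div_nine_le_kOutExpansion (hk : k ≤ n) :
    m * ((k : ℝ) / n) / 9 ≤ kOutExpansion n k m := by
  have hβ : (k : ℝ) / n ≤ 1 := div_le_one_of_le₀ (by exact_mod_cast hk) n.cast_nonneg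
  have hd : 0 ≤ m * ((k : ℝ) / n) := by positivity
  rw [kOutExpansion]
  nlinarith

theorem kOutExpansion_pos (hk : k ≤ n) (hd : 0 < m * ((k : ℝ) / n)) : 0 < kOutExpansion n k m :=
  (div_pos hd (by norm_num)).trans_le (div_nine_le_kOutExpansion hk)

theorem two_div_kOutExpansion_le (hk : k ≤ n) (hd : 0 < m * ((k : ℝ) / n)) :
    2 / kOutExpansion n k m ≤ 3 / (m * ((k : ℝ) / n)) + 15 / m := by
  have hτ := kOutExpansion_pos hk hd
  have hm : (0 : ℝ) < m := pos_of_mul_pos_left hd (by positivity)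
  have hβ0 : 0 < (k : ℝ) / n := pos_of_mul_pos_right hd m.cast_nonneg
  have hβ1 : (k : ℝ) / n ≤ 1 := div_le_one_of_le₀ (by exact_mod_cast hk) n.cast_nonneg
  rw [kOutExpansion] at hτ ⊢
  set β := (k : ℝ) / n
  have hfactor : 1 ≤ (1 + 5 * β) * (1 - 5 / 6 * β) := by nlinarith
  have hsum : 3 / (m * β) + 15 / m = 3 * (1 + 5 * β) / (m * β) := by
    field_simp
    ring
  rw [hsum, div_le_div_iff₀ hτ hd]
  nlinarith

theorem natLog_two_mul_le_log (hm : m ≠ 0) : Nat.log 2 m * 0.69 ≤ Real.log m := by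
  have hpow : (2 : ℝ) ^ Nat.log 2 m ≤ m := by exact_mod_cast Nat.pow_log_le_self 2 hm
  calc Nat.log 2 m * 0.69 ≤ Nat.log 2 m * Real.log 2 := by
        gcongr
        linarith [Real.log_two_gt_d9]
    _ = Real.log (2 ^ Nat.log 2 m) := (Real.log_pow _ _).symm
    _ ≤ Real.log m := Real.log_le_log (by positivity) hpow

theorem six_mul_natLog_div_kOutExpansion_le (hk : k ≤ n) (hm : 81 ≤ m)
    (hd : 20 ≤ m * ((k : ℝ) / n)) :
    6 * Nat.log 2 m / (kOutExpansion n k m * m) ≤ (6 * Real.log m - 3) / m := by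
  have hmR : (81 : ℝ) ≤ m := by exact_mod_cast hm
  have hlog : 4.3 ≤ Real.log m := by
    have hlogm := lt_log_two_mul hmR
    rw [Real.log_mul two_ne_zero (by positivity)] at hlogm
    linarith [Real.log_two_lt_d9]
  have hτ : 20 / 9 ≤ kOutExpansion n k m := by linarith [div_nine_le_kOutExpansion (m := m) hk]
  have hlog2 := natLog_two_mul_le_log (m := m) (by omega)
  rw [← div_div]
  gcongr
  rw [div_le_iff₀ (by linarith)]
  nlinarith

theorem floor_sub_one_pos_and_three_div_le {ρ k : ℝ} (hρ0 : 0 ≤ ρ) (hρ1 : ρ ≤ 1)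
    (hρk : 20 ≤ ρ * k) :
    (0 : ℝ) < ⌊(k - 1) * ρ / 3⌋ - 1 ∧ 3 / (ρ * k) ≤ 1 / ((⌊(k - 1) * ρ / 3⌋ : ℝ) - 1) := by
  have hle := Int.floor_le ((k - 1) * ρ / 3)
  have hlt := Int.lt_floor_add_one ((k - 1) * ρ / 3)
  have hpos : (0 : ℝ) < ⌊(k - 1) * ρ / 3⌋ - 1 := by linarith
  exact ⟨hpos, by rw [div_le_div_iff₀ (by linarith) hpos]; linarith⟩

end KOutEnergy

section Privacy

variable {n : ℕ} {H : Finset (Fin n)} {G : SimpleGraph (Fin n)} {ε δ δ' c κ : ℝ}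
  {varEta varDelta : ℝ≥0}

theorem isDP_gopa_of_induce_eq_top (hG : G.induce (H : Set (Fin n)) = ⊤) (hε0 : 0 < ε)
    (hε1 : ε ≤ 1) (hδ'0 : 0 < δ') (hδ'1 : δ' ≤ 1) (hc : 2 * Real.log (1.25 / δ') < c ^ 2)
    (hκ : 0 < κ) (hEta : (varEta : ℝ) = c ^ 2 / (H.card * ε ^ 2))
    (hDelta : (varDelta : ℝ) = κ * varEta) (hδ : 1.25 * (δ' / 1.25) ^ (κ / (κ + 1)) ≤ δ)
    (ν : ProbabilityMeasure (Noise n)) : IsDP H ε δ (gopa G H varEta varDelta ν) := by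
  intro v hv
  have hm : (0 : ℝ) < H.card := by exact_mod_cast Finset.card_pos.2 ⟨v, hv⟩
  refine isDP_gopa_of_exists_isSpreadingFlow (B := 1 / H.card) (by positivity) (fun w => ?_) hε0
    hε1 hδ'0 hδ'1 hc hκ hEta (by rw [hDelta]; field_simp) hδ ν v hv
  obtain ⟨g, hg, hgB⟩ := exists_isSpreadingFlow_top w
  rw [← Set.toFinset_card, Finset.toFinset_coe] at hgB
  exact ⟨g, hG ▸ hg, hgB⟩

theorem isDP_gopa_of_induce_connected (hG : (G.induce (H : Set (Fin n))).Connected) (hε0 : 0 < ε)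
    (hε1 : ε ≤ 1) (hδ'0 : 0 < δ') (hδ'1 : δ' ≤ 1) (hc : 2 * Real.log (1.25 / δ') < c ^ 2)
    (hκ : 0 < κ) (hEta : (varEta : ℝ) = c ^ 2 / (H.card * ε ^ 2))
    (hDelta : (varDelta : ℝ) = κ * varEta * (H.card : ℝ) ^ 2 / 3)
    (hδ : 1.25 * (δ' / 1.25) ^ (κ / (κ + 1)) ≤ δ) (ν : ProbabilityMeasure (Noise n)) :
    IsDP H ε δ (gopa G H varEta varDelta ν) := by
  intro v hv
  have hm : (0 : ℝ) < H.card := by exact_mod_cast Finset.card_pos.2 ⟨v, hv⟩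
  refine isDP_gopa_of_exists_isSpreadingFlow (B := H.card / 3) (by positivity) (fun w => ?_) hε0
    hε1 hδ'0 hδ'1 hc hκ hEta (by rw [hDelta]; ring) hδ ν v hv
  obtain ⟨g, hg, hgB⟩ := exists_isSpreadingFlow_of_connected hG w
  rw [← Set.toFinset_card, Finset.toFinset_coe] at hgB
  exact ⟨g, hg, hgB⟩

theorem isDP_gopa_of_isExpanding_kOutExpansion {k : ℕ} {ρ : ℝ} (hρ : ρ = (H.card : ℝ) / n)
    (hk : k < n) (hm : 81 ≤ H.card) (hρk : 20 ≤ ρ * k)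
    (hG : IsExpanding (G.induce (H : Set (Fin n))) (kOutExpansion n k H.card)) (hε0 : 0 < ε)
    (hε1 : ε ≤ 1) (hδ'0 : 0 < δ') (hδ'1 : δ' ≤ 1) (hc : 2 * Real.log (1.25 / δ') < c ^ 2)
    (hκ : 0 < κ) (hEta : (varEta : ℝ) = c ^ 2 / (H.card * ε ^ 2))
    (hDelta : (varDelta : ℝ) = κ * varEta * H.card *
      (1 / ((⌊((k : ℝ) - 1) * ρ / 3⌋ : ℝ) - 1) + (12 + 6 * Real.log H.card) / H.card))
    (hδ : 1.25 * (δ' / 1.25) ^ (κ / (κ + 1)) ≤ δ) (ν : ProbabilityMeasure (Noise n)) :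
    IsDP H ε δ (gopa G H varEta varDelta ν) := by
  have hρ0 : 0 ≤ ρ := by rw [hρ]; positivity
  have hρ1 : ρ ≤ 1 := by
    rw [hρ]
    exact div_le_one_of_le₀ (by exact_mod_cast card_finset_fin_le H) n.cast_nonneg
  have hd : ρ * k = H.card * ((k : ℝ) / n) := by rw [hρ]; ring
  obtain ⟨hK, hKd⟩ := floor_sub_one_pos_and_three_div_le hρ0 hρ1 hρk
  rw [hd] at hρk hKd
  have hd0 : 0 < H.card * ((k : ℝ) / n) := by linarith
  have : 0 ≤ Real.log H.card := Real.log_natCast_nonneg _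
  refine isDP_gopa_of_exists_isSpreadingFlow (by positivity) (fun w => ?_) hε0 hε1 hδ'0 hδ'1 hc hκ
    hEta hDelta hδ ν
  obtain ⟨g, hg, hgB⟩ := exists_isSpreadingFlow_of_isExpanding (kOutExpansion_pos hk.le hd0) hG w
  rw [← Set.toFinset_card, Finset.toFinset_coe] at hgB
  refine ⟨g, hg, hgB.trans ?_⟩
  have hadd : (12 + 6 * Real.log H.card) / H.card =
      15 / H.card + (6 * Real.log H.card - 3) / H.card := by ring
  linarith [two_div_kOutExpansion_le hk.le hd0, six_mul_natLog_div_kOutExpansion_le hk.le hm hρk]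

theorem isDP_gopaOnRandomGraph_kOutGraph {k : ℕ} {ρ : ℝ} (hρ : ρ = (H.card : ℝ) / n) (hk : k < n)
    (hm : 81 ≤ ρ * n) (hρk : 4 * Real.log (2 * ρ * n / δ) ≤ ρ * k) (hε0 : 0 < ε) (hε1 : ε ≤ 1)
    (hδ'0 : 0 < δ') (hδ'1 : δ' ≤ 1) (hc : 2 * Real.log (1.25 / δ') < c ^ 2) (hκ : 0 < κ)
    (hEta : (varEta : ℝ) = c ^ 2 / (H.card * ε ^ 2))
    (hDelta : (varDelta : ℝ) = κ * varEta * H.card *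
      (1 / ((⌊((k : ℝ) - 1) * ρ / 3⌋ : ℝ) - 1) + (12 + 6 * Real.log H.card) / H.card))
    (hδ : 3.75 * (δ' / 1.25) ^ (κ / (κ + 1)) ≤ δ) (Q : PMF (Fin n → Finset (Fin n)))
    (ν : SimpleGraph (Fin n) → ProbabilityMeasure (Noise n)) :
    IsDP H ε δ (gopaOnRandomGraph (kOutGraph H k hk Q) H varEta varDelta ν) := by
  rcases le_or_gt 1 δ with hδ1 | hδ1
  · exact isDP_of_one_le hδ1
  have hδ0 : 0 < δ := by
    have : 0 < (δ' / 1.25) ^ (κ / (κ + 1)) := by positivity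
    linarith
  have hn : (n : ℝ) ≠ 0 := by exact_mod_cast (Nat.zero_lt_of_lt hk).ne'
  have hρn : ρ * n = H.card := by rw [hρ]; field_simp
  rw [hρn] at hm
  rw [mul_assoc, hρn] at hρk
  have hρk20 : 20 ≤ ρ * k := by
    have hmono : Real.log (2 * H.card) ≤ Real.log (2 * H.card / δ) :=
      Real.log_le_log (by linarith) (le_div_self (by positivity) hδ0 hδ1.le)
    linarith [lt_log_two_mul hm]
  have hm81 : 81 ≤ H.card := by exact_mod_cast hm
  have hd : ρ * k = H.card * ((k : ℝ) / n) := by rw [hρ]; ring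
  rw [show δ = δ / 3 + 2 / 3 * δ by ring]
  refine isDP_gopaOnRandomGraph (by positivity) (by positivity)
    (kOutGraph_not_isExpanding_le hk hm81 hδ0 hδ1.le (hd ▸ hρk) Q) fun G hG => ?_
  exact isDP_gopa_of_isExpanding_kOutExpansion hρ hk hm81 hρk20 (not_not.1 hG) hε0 hε1 hδ'0 hδ'1
    hc hκ hEta hDelta (by linarith) (ν G)

end Privacy

end Gopa

theorem corollary1_general (n : ℕ) (H : Finset (Fin n)) (ρ : ℝ) (hρ : ρ = (H.card : ℝ) / n)
    (ε δ' c κ : ℝ) (hε0 : 0 < ε) (hε1 : ε ≤ 1) (hδ'0 : 0 < δ') (hδ'1 : δ' ≤ 1)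
    (hc : 2 * Real.log (1.25 / δ') < c ^ 2) (hκ : 0 < κ)
    (varEta : ℝ≥0) (hEta : (varEta : ℝ) = c ^ 2 / (H.card * ε ^ 2)) :
    (∀ G : SimpleGraph (Fin n), G.induce (H : Set (Fin n)) = ⊤ →
      ∀ varDelta : ℝ≥0, (varDelta : ℝ) = κ * varEta →
      ∀ δ : ℝ, 1.25 * (δ' / 1.25) ^ (κ / (κ + 1)) ≤ δ →
      ∀ ν : ProbabilityMeasure (Gopa.Noise n),
        Gopa.IsDP H ε δ (Gopa.gopa G H varEta varDelta ν)) ∧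
    (∀ (k : ℕ) (hk : k < n) (varDelta : ℝ≥0),
      (varDelta : ℝ) = κ * varEta * H.card *
        (1 / ((⌊((k : ℝ) - 1) * ρ / 3⌋ : ℝ) - 1) + (12 + 6 * Real.log H.card) / H.card) →
      ∀ δ : ℝ, 3.75 * (δ' / 1.25) ^ (κ / (κ + 1)) ≤ δ →
      81 ≤ ρ * n →
      4 * Real.log (2 * ρ * n / δ) ≤ ρ * k →
      ∀ (Q : PMF (Fin n → Finset (Fin n)))
        (ν : SimpleGraph (Fin n) → ProbabilityMeasure (Gopa.Noise n)),
        Gopa.IsDP H ε δ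
          (Gopa.gopaOnRandomGraph (Gopa.kOutGraph H k hk Q) H varEta varDelta ν)) ∧
    (∀ G : SimpleGraph (Fin n), (G.induce (H : Set (Fin n))).Connected →
      ∀ varDelta : ℝ≥0, (varDelta : ℝ) = κ * varEta * (H.card : ℝ) ^ 2 / 3 →
      ∀ δ : ℝ, 1.25 * (δ' / 1.25) ^ (κ / (κ + 1)) ≤ δ →
      ∀ ν : ProbabilityMeasure (Gopa.Noise n),
        Gopa.IsDP H ε δ (Gopa.gopa G H varEta varDelta ν)) := by
  refine ⟨fun G hG varDelta hDelta δ hδ ν => ?_, fun k hk varDelta hDelta δ hδ hm hρk Q ν => ?_,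
    fun G hG varDelta hDelta δ hδ ν => ?_⟩
  · exact Gopa.isDP_gopa_of_induce_eq_top hG hε0 hε1 hδ'0 hδ'1 hc hκ hEta hDelta hδ ν
  · exact Gopa.isDP_gopaOnRandomGraph_kOutGraph hρ hk hm hρk hε0 hε1 hδ'0 hδ'1 hc hκ hEta hDelta
      hδ Q ν
  · exact Gopa.isDP_gopa_of_induce_connected hG hε0 hε1 hδ'0 hδ'1 hc hκ hEta hDelta hδ ν

theorem corollary1 (n : ℕ) (H : Finset (Fin n)) (ρ : ℝ) (hρ : ρ = (H.card : ℝ) / n)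
    (ε δ' c κ : ℝ) (hε0 : 0 < ε) (hε1 : ε < 1) (hδ'0 : 0 < δ') (hδ'1 : δ' < 1)
    (hc : 2 * Real.log (1.25 / δ') < c ^ 2) (hκ : 0 < κ)
    (varEta : ℝ≥0) (hEta : (varEta : ℝ) = c ^ 2 / (H.card * ε ^ 2)) :
    -- complete graph
    (∀ G : SimpleGraph (Fin n), G.induce (H : Set (Fin n)) = ⊤ →
      ∀ varDelta : ℝ≥0, (varDelta : ℝ) = κ * varEta →
      ∀ δ : ℝ, 1.25 * (δ' / 1.25) ^ (κ / (κ + 1)) ≤ δ →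
      ∀ ν : ProbabilityMeasure (Gopa.Noise n),
        Gopa.IsDP H ε δ (Gopa.gopa G H varEta varDelta ν)) ∧
    -- random `k`-out graph
    (∀ (k : ℕ) (hk : k < n) (varDelta : ℝ≥0),
      (varDelta : ℝ) = κ * varEta * H.card *
        (1 / ((⌊((k : ℝ) - 1) * ρ / 3⌋ : ℝ) - 1) + (12 + 6 * Real.log H.card) / H.card) →
      ∀ δ : ℝ, 3.75 * (δ' / 1.25) ^ (κ / (κ + 1)) ≤ δ →
      81 ≤ ρ * n →
      4 * Real.log (2 * ρ * n / (3 * (δ / 3))) ≤ ρ * k →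
      6 * Real.log (ρ * n / 3) ≤ ρ * k →
      3 / 2 + 9 / 4 * Real.log (2 * Real.exp 1 / (δ / 3)) ≤ ρ * k →
      ∀ (Q : PMF (Fin n → Finset (Fin n)))
        (ν : SimpleGraph (Fin n) → ProbabilityMeasure (Gopa.Noise n)),
        Gopa.IsDP H ε δ
          (Gopa.gopaOnRandomGraph (Gopa.kOutGraph H k hk Q) H varEta varDelta ν)) ∧
    -- arbitrary connected honest subgraph
    (∀ G : SimpleGraph (Fin n), (G.induce (H : Set (Fin n))).Connected →
      ∀ varDelta : ℝ≥0, (varDelta : ℝ) = κ * varEta * (H.card : ℝ) ^ 2 / 3 →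
      ∀ δ : ℝ, 1.25 * (δ' / 1.25) ^ (κ / (κ + 1)) ≤ δ →
      ∀ ν : ProbabilityMeasure (Gopa.Noise n),
        Gopa.IsDP H ε δ (Gopa.gopa G H varEta varDelta ν)) :=
  have ⟨hcomplete, hkOut, hconnected⟩ :=
    corollary1_general n H ρ hρ ε δ' c κ hε0 hε1.le hδ'0 hδ'1.le hc hκ varEta hEta
  ⟨hcomplete, fun k hk D hD δ hδ hm hρk _ _ => hkOut k hk D hD δ hδ hm
    (by rwa [mul_div_cancel₀ δ three_ne_zero] at hρk), hconnected⟩
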